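/- For an integer $n$ and a real $d>1$ put $$m=m(n,d)=\frac{\log n\cdot\log\log\log n}{\log\log n\cdot\log d},$$ where $\log$ is the natural logarithm. For a set $S$ of vertices of a graph $G=(V,E)$ let $N(S)=\{v\in V\setminus S:\ \exists u\in S,\ uv\in E\}$ be its external neighbourhood. There is an absolute constant $n_0$ such that for every integer $n\ge n_0$ and every real $d$ with $12\le d\le e^{\sqrt[3]{\log n}}$ the following holds. Let $G=(V,E)$ be a graph on $n$ vertices such that P1: every $S\subseteq V$ with $|S|\le \frac{n}{d\,m}$ satisfies $|N(S)|\ge d|S|$; and P2: for any two disjoint sets $A,B\subseteq V$ with $|A|,|B|\ge \frac{n}{4130\,m}$ there is an edge of $G$ between $A$ and $B$. Then $G$ is Hamiltonian, that is, it contains a cycle through all of its vertices. -/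

import Mathlib

namespace HamiltonExpansion

/-- The external neighbourhood `N(S)` of a vertex set `S`: all vertices outside `S` that have a
neighbour in `S`. -/
noncomputable def extNeighbors {V : Type*} [Fintype V] (G : SimpleGraph V) (S : Finset V) :
    Finset V :=
  open scoped Classical in Finset.univ.filter (fun v => v ∉ S ∧ ∃ u ∈ S, G.Adj u v)

/-- `m(n, d) = (log n · log log log n) / (log log n · log d)`, with natural logarithms. -/
noncomputable def m (n : ℕ) (d : ℝ) : ℝ :=
  (Real.log n * Real.log (Real.log (Real.log n))) / (Real.log (Real.log n) * Real.log d)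

/-- Property P1 (expansion), for a graph on `n = |V|` vertices: every vertex set `S` with
`|S| ≤ n / (d m)` satisfies `|N(S)| ≥ d |S|`. -/
def P1 {V : Type*} [Fintype V] (G : SimpleGraph V) (d : ℝ) : Prop :=
  ∀ S : Finset V,
    (S.card : ℝ) ≤ (Fintype.card V : ℝ) / (d * m (Fintype.card V) d) →
      d * (S.card : ℝ) ≤ ((extNeighbors G S).card : ℝ)

/-- Property P2 (high connectivity), for a graph on `n = |V|` vertices: any two disjoint vertex
sets `A`, `B` with `|A|, |B| ≥ n / (4130 m)` are joined by an edge. -/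
def P2 {V : Type*} [Fintype V] (G : SimpleGraph V) (d : ℝ) : Prop :=
  ∀ A B : Finset V, Disjoint A B →
    (Fintype.card V : ℝ) / (4130 * m (Fintype.card V) d) ≤ (A.card : ℝ) →
    (Fintype.card V : ℝ) / (4130 * m (Fintype.card V) d) ≤ (B.card : ℝ) →
      ∃ a ∈ A, ∃ b ∈ B, G.Adj a b

end HamiltonExpansion

/-! The engine is Pósa rotation. If the last vertex of a path is adjacent to `x` and `y` follows
`x`, reversing everything after `x` gives a path on the same vertices ending in `y`. In a longest
path all neighbours of an end lie on the path. It suffices to find a longest path with adjacent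
ends: if the resulting cycle missed a vertex, expansion would give an edge leaving it, hence a
longer path (`isHamiltonian_of_cycle`).

By P1 the set of ends grows by a factor of `(d - 1) / 2` per rotation, and P2 then brings it to `n /
4`, after about `2 log n / log d` rotations in all (`IsLongestPath.many_ends`). Moving both ends
yields `n² / 16` end pairs (`IsLongestPath.card_goodPairs`). This alone closes no cycle, since the
ends available on one side depend on the path chosen for the other.

To decouple the sides, a path is cut in two and each half is rotated with the cut held fixed. Each
half must then expand into itself, which blocks ensure. An initial longest path contains `3h + 1`
disjoint blocks and each rotation breaks at most one, so enough survive for both halves to hold `h`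
of them (`exists_cut`). Pigeonhole fixes `k` oriented blocks per side shared by many pairs
(`exists_common_subsets`). By P2 small sets expand more than twofold into the interiors of these
blocks once fewer than `b` exceptional vertices are excluded (`Linked.exists_exceptional`). The
exceptional sets depend only on the blocks, so some pair avoids them. Its halves then acquire more
than `b` ends each, and P2 joins the two sets (`IsLongestPath.exists_closing`). -/

namespace HamiltonExpansion

/-! ### Consecutive entries of lists and blocks surviving a rotation -/

section Lists

variable {V : Type*}

theorem infix_split {I A B : List V} {x : V} (h : I <:+: A ++ x :: B) (hx : x ∉ I) :
    I <:+: A ∨ I <:+: x :: B := by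
  rcases List.infix_append_iff_ne_nil.1 h with h | h | ⟨t₁, t₂, _, h2, rfl, _, hp⟩
  · exact Or.inl h
  · exact Or.inr h
  · obtain ⟨y, t, rfl⟩ := List.exists_cons_of_ne_nil h2
    rw [List.cons_prefix_cons] at hp
    simp [hp.1] at hx

theorem infix_of_infix_cons {I B : List V} {x : V} (h : I <:+: x :: B) (hx : x ∉ I) :
    I <:+: B := by
  rcases List.infix_cons_iff.1 h with h | h
  · rcases I with _ | ⟨y, t⟩
    · exact List.nil_infix
    · rw [List.cons_prefix_cons] at h
      simp [h.1] at hx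
  · exact h

theorem succ_unique {p : List V} (hp : p.Nodup) {z w w' : V} (h : [z, w] <:+: p)
    (h' : [z, w'] <:+: p) : w = w' := by
  obtain ⟨a, b, rfl⟩ := h
  obtain ⟨c, d, h⟩ := h'
  have h1 : a ++ z :: (w :: b) = c ++ z :: (w' :: d) := by simpa using h.symm
  have hn : (a ++ z :: (w :: b)).Nodup := by simpa using hp
  have notMem : ∀ {s t : List V}, (s ++ z :: t).Nodup → z ∉ s := fun hst hz =>
    List.disjoint_of_nodup_append hst hz (List.mem_cons_self)
  have ha := notMem hn
  have hc := notMem (h1 ▸ hn)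
  rcases List.append_eq_append_iff.1 h1 with ⟨e, rfl, h2⟩ | ⟨e, rfl, h2⟩ <;>
    cases e <;> simp_all

theorem pred_unique {p : List V} (hp : p.Nodup) {z w w' : V} (h : [w, z] <:+: p)
    (h' : [w', z] <:+: p) : w = w' :=
  succ_unique (p := p.reverse) (List.nodup_reverse.2 hp) (z := z)
    (by simpa using List.reverse_infix.2 h) (by simpa using List.reverse_infix.2 h')

/-- An entry of a list without repetitions has at most one successor and one predecessor. This is
the source of the factor 2 in Pósa's argument. -/
theorem card_le_two_mul_of_neighbors {p : List V} (hp : p.Nodup) {W R : Finset V}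
    (h : ∀ w ∈ W, ∃ z ∈ R, [z, w] <:+: p ∨ [w, z] <:+: p) : W.card ≤ 2 * R.card := by
  classical
  have key : ∀ P : V → V → Prop, (∀ z w w', P z w → P z w' → w = w') →
      ∀ W' : Finset V, (∀ w ∈ W', ∃ z ∈ R, P z w) → W'.card ≤ R.card := by
    intro P hP W' hW'
    have hc : ∀ w : V, ∃ z : V, w ∈ W' → z ∈ R ∧ P z w := by
      intro w
      by_cases hw : w ∈ W'
      · obtain ⟨z, hz⟩ := hW' w hw
        exact ⟨z, fun _ => hz⟩
      · exact ⟨w, fun h => absurd h hw⟩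
    choose f hf using hc
    refine Finset.card_le_card_of_injOn f (fun w hw => (hf w hw).1) ?_
    intro w hw w' hw' hww
    have h1 := (hf w hw).2
    rw [hww] at h1
    exact hP _ _ _ h1 (hf w' hw').2
  have h1 := key (fun z w => [z, w] <:+: p) (fun z w w' => succ_unique hp)
    (W.filter fun w => ∃ z ∈ R, [z, w] <:+: p) (fun w hw => (Finset.mem_filter.1 hw).2)
  have h2 := key (fun z w => [w, z] <:+: p) (fun z w w' => pred_unique hp)
    (W.filter fun w => ∃ z ∈ R, [w, z] <:+: p) (fun w hw => (Finset.mem_filter.1 hw).2)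
  have h3 : W ⊆ (W.filter fun w => ∃ z ∈ R, [z, w] <:+: p) ∪
      (W.filter fun w => ∃ z ∈ R, [w, z] <:+: p) := by
    intro w hw
    obtain ⟨z, hz, hzw⟩ := h w hw
    simp only [Finset.mem_union, Finset.mem_filter]
    rcases hzw with hzw | hzw
    · exact Or.inl ⟨hw, z, hz, hzw⟩
    · exact Or.inr ⟨hw, z, hz, hzw⟩
  have := (Finset.card_le_card h3).trans (Finset.card_union_le _ _)
  omega

/-- `I` or its reversal is a block of consecutive entries of `q`. -/
def Unbroken (I q : List V) : Prop := I <:+: q ∨ I.reverse <:+: q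

theorem Unbroken.reverse {I q : List V} (h : Unbroken I q) : Unbroken I q.reverse := by
  rcases h with h | h
  · exact Or.inr (List.reverse_infix.2 h)
  · left
    simpa using List.reverse_infix.2 h

/-- A block missing `y` lies wholly in the untouched part up to `x` or in the reversed tail.
Charging the broken edge to the single vertex `y` is what limits the loss to one of several disjoint
blocks. -/
theorem Unbroken.rotate {I l t : List V} {x y : V} (h : Unbroken I (l ++ x :: y :: t))
    (hy : y ∉ I) : Unbroken I (l ++ x :: (y :: t).reverse) := by
  have key : ∀ J : List V, J <:+: l ++ x :: y :: t → y ∉ J →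
      J <:+: l ++ x :: (y :: t).reverse ∨ J.reverse <:+: l ++ x :: (y :: t).reverse := by
    intro J hJ hyJ
    have hJ' : J <:+: (l ++ [x]) ++ y :: t := by simpa using hJ
    rcases infix_split hJ' hyJ with h | h
    · left
      have := h.trans (List.infix_append_left (l₁ := l ++ [x]) (l₂ := (y :: t).reverse))
      simpa using this
    · right
      have := (List.reverse_infix.2 h).trans
        (List.infix_append_right (l₁ := l ++ [x]) (l₂ := (y :: t).reverse))
      simpa using this
  rcases h with h | h
  · exact key I h hy
  · have := key I.reverse h (by simpa using hy)
    rw [List.reverse_reverse] at this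
    exact this.symm

theorem Unbroken.split {I A B : List V} {x : V} (h : Unbroken I (A ++ x :: B)) (hx : x ∉ I) :
    Unbroken I A ∨ Unbroken I B := by
  rcases h with h | h
  · rcases infix_split h hx with h | h
    · exact Or.inl (Or.inl h)
    · exact Or.inr (Or.inl (infix_of_infix_cons h hx))
  · have hx' : x ∉ I.reverse := by simpa using hx
    rcases infix_split h hx' with h | h
    · exact Or.inl (Or.inr h)
    · exact Or.inr (Or.inr (infix_of_infix_cons h hx'))

variable {ι : Type*} [Fintype ι]

open scoped Classical in
/-- The indices of the blocks of the family `I` that are unbroken in `q`. -/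
noncomputable def unbrokenSet (I : ι → List V) (q : List V) : Finset ι :=
  Finset.univ.filter fun j => Unbroken (I j) q

theorem card_filter_mem_le_one {I : ι → List V} (hI : Pairwise fun i j => (I i).Disjoint (I j))
    (y : V) [DecidablePred fun j => y ∈ I j] : (Finset.univ.filter fun j => y ∈ I j).card ≤ 1 := by
  refine Finset.card_le_one.2 fun i hi j hj => ?_
  by_contra hij
  exact hI hij (Finset.mem_filter.1 hi).2 (Finset.mem_filter.1 hj).2

theorem card_unbrokenSet_rotate {I : ι → List V} (hI : Pairwise fun i j => (I i).Disjoint (I j))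
    (l : List V) (x y : V) (t : List V) :
    (unbrokenSet I (l ++ x :: y :: t)).card ≤
      (unbrokenSet I (l ++ x :: (y :: t).reverse)).card + 1 := by
  classical
  have h : unbrokenSet I (l ++ x :: y :: t) ⊆ unbrokenSet I (l ++ x :: (y :: t).reverse) ∪
      Finset.univ.filter fun j => y ∈ I j := by
    intro j hj
    simp only [unbrokenSet, Finset.mem_union, Finset.mem_filter, Finset.mem_univ, true_and] at hj ⊢
    by_cases hy : y ∈ I j
    · exact Or.inr hy
    · exact Or.inl (hj.rotate hy)
  have h1 := (Finset.card_le_card h).trans (Finset.card_union_le _ _)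
  have h2 := card_filter_mem_le_one hI y
  omega

theorem card_unbrokenSet_reverse (I : ι → List V) (q : List V) :
    (unbrokenSet I q).card ≤ (unbrokenSet I q.reverse).card := by
  refine Finset.card_le_card fun j hj => ?_
  simp only [unbrokenSet, Finset.mem_filter, Finset.mem_univ, true_and] at hj ⊢
  exact hj.reverse

theorem exists_cut {I : ι → List V} (hI : Pairwise fun i j => (I i).Disjoint (I j))
    {q : List V} {h : ℕ} (hq : 2 * h + 1 ≤ (unbrokenSet I q).card) :
    ∃ q₁ q₂, q = q₁ ++ q₂ ∧ h ≤ (unbrokenSet I q₁).card ∧ h ≤ (unbrokenSet I q₂).card := by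
  classical
  have hex : ∃ i, i ≤ q.length ∧ h ≤ (unbrokenSet I (q.take i)).card :=
    ⟨q.length, le_rfl, by rw [List.take_length]; omega⟩
  obtain ⟨hi, hh⟩ := Nat.find_spec hex
  have hmin := fun j => Nat.find_min hex (m := j)
  generalize Nat.find hex = i at hi hh hmin
  refine ⟨q.take i, q.drop i, (List.take_append_drop i q).symm, hh, ?_⟩
  rcases i with _ | j
  · rw [List.drop_zero]; omega
  -- By minimality the prefix without `q[j]` has fewer than `h` blocks, and `q[j]` meets at most
  -- one, so at least `h + 1` of the `2 * h + 1` lie beyond it.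
  · have hj := hmin j (by omega)
    have hlt : (unbrokenSet I (q.take j)).card < h := by
      by_contra hcon
      exact hj ⟨by omega, by omega⟩
    have hjl : j < q.length := by omega
    have hsub : unbrokenSet I q ⊆ (unbrokenSet I (q.take j) ∪ unbrokenSet I (q.drop (j + 1))) ∪
        Finset.univ.filter fun i => q[j] ∈ I i := by
      intro i hi
      simp only [unbrokenSet, Finset.mem_union, Finset.mem_filter, Finset.mem_univ,
        true_and] at hi ⊢
      by_cases hy : q[j] ∈ I i
      · exact Or.inr hy
      · refine Or.inl (Unbroken.split (x := q[j]) ?_ hy)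
        rw [← List.drop_eq_getElem_cons hjl, List.take_append_drop]
        exact hi
    have h1 := (Finset.card_le_card hsub).trans (Finset.card_union_le _ _)
    have h2 := Finset.card_union_le (unbrokenSet I (q.take j)) (unbrokenSet I (q.drop (j + 1)))
    have h3 := card_filter_mem_le_one hI q[j]
    omega

end Lists

/-! ### Pósa rotations and the ends they reach -/

section Rotations

variable {V : Type*}

/-- The list `q` arises from the path `p` by `i` Pósa rotations that fix the first vertex and
whose new last vertices all lie in `C`. -/
inductive Reach (G : SimpleGraph V) (C : Set V) (p : List V) : ℕ → List V → Prop
  | refl : Reach G C p 0 p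
  | rotate {i : ℕ} {l : List V} {x y : V} {t : List V} : Reach G C p i (l ++ x :: y :: t) →
      y ∈ C → G.Adj x ((y :: t).getLast (by simp)) → Reach G C p (i + 1) (l ++ x :: (y :: t).reverse)

/-- The last vertices of the lists reachable from `p` by at most `i` rotations. -/
def ends (G : SimpleGraph V) (C : Set V) (p : List V) (i : ℕ) : Set V :=
  {r | ∃ j ≤ i, ∃ q, Reach G C p j q ∧ r ∈ q.getLast?}

variable {G : SimpleGraph V} {C : Set V} {p q : List V} {i j : ℕ}

theorem ends_mono (h : i ≤ j) : ends G C p i ⊆ ends G C p j := by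
  rintro r ⟨k, hk, q, hq⟩
  exact ⟨k, hk.trans h, q, hq⟩

theorem Reach.perm (h : Reach G C p i q) : q.Perm p := by
  induction h with
  | refl => exact List.Perm.refl _
  | rotate h _ _ ih =>
    exact ((List.Perm.cons _ (List.reverse_perm _)).append_left _).trans ih

theorem Reach.head?_eq (h : Reach G C p i q) : q.head? = p.head? := by
  induction h with
  | refl => rfl
  | @rotate i l x y t h _ _ ih =>
    rw [← ih]
    cases l <;> simp

theorem Reach.isChain (h : Reach G C p i q) (hp : p.IsChain G.Adj) : q.IsChain G.Adj := by
  induction h with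
  | refl => exact hp
  | @rotate i l x y t h _ hadj ih =>
    rw [List.isChain_append] at ih ⊢
    obtain ⟨h1, h2, h3⟩ := ih
    refine ⟨h1, ?_, ?_⟩
    · rw [List.isChain_cons] at h2 ⊢
      refine ⟨?_, ?_⟩
      · intro z hz
        rw [List.head?_reverse, List.getLast?_eq_getLast_of_ne_nil (List.cons_ne_nil _ _)] at hz
        simp only [Option.mem_def, Option.some.injEq] at hz
        rw [← hz]
        exact hadj
      · rw [List.isChain_reverse]
        exact h2.2.imp fun a b hab => hab.symm
    · intro a ha b hb
      exact h3 a ha b (by simpa using hb)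

theorem Reach.getLast_mem_ends (h : Reach G C p i q) {r : V} (hr : r ∈ q.getLast?) :
    r ∈ ends G C p i := ⟨i, le_rfl, q, h, hr⟩

theorem getLast?_rotate (l t : List V) (x y : V) :
    (l ++ x :: (y :: t).reverse).getLast? = some y := by
  have : l ++ x :: (y :: t).reverse = (l ++ x :: t.reverse) ++ [y] := by simp
  rw [this, List.getLast?_concat]

theorem Reach.rotate_getLast {l t : List V} {x y : V}
    (h : Reach G C p i (l ++ x :: (y :: t).reverse)) : y ∈ ends G C p i :=
  h.getLast_mem_ends (getLast?_rotate l t x y)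

theorem ends_subset {a : V} (ha : p.getLast? = some a) (hC : a ∈ C) : ends G C p i ⊆ C := by
  rintro r ⟨j, -, q, hq, hr⟩
  cases hq with
  | refl =>
    rw [ha] at hr
    simp only [Option.mem_def, Option.some.injEq] at hr
    exact hr ▸ hC
  | @rotate i l x y t h hy _ =>
    rw [getLast?_rotate] at hr
    simp only [Option.mem_def, Option.some.injEq] at hr
    exact hr ▸ hy

/-- Each rotation makes `y`, the far vertex of the broken edge, a new end; a block free of ends is
therefore never cut. -/
theorem Reach.unbroken (h : Reach G C p i q) {I : List V} (hI : Unbroken I p)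
    (hz : ∀ z ∈ I, z ∉ ends G C p i) : Unbroken I q := by
  induction h with
  | refl => exact hI
  | @rotate i l x y t h hy hadj ih =>
    have h' := Reach.rotate h hy hadj
    exact (ih fun z hzI hze => hz z hzI (ends_mono (Nat.le_succ i) hze)).rotate
      fun hyI => hz y hyI h'.rotate_getLast

theorem Reach.card_unbrokenSet {ι : Type*} [Fintype ι] {I : ι → List V}
    (hI : Pairwise fun i j => (I i).Disjoint (I j)) (h : Reach G C p i q) :
    (unbrokenSet I p).card ≤ (unbrokenSet I q).card + i := by
  induction h with
  | refl => simp
  | @rotate i l x y t h hy hadj ih =>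
    have := card_unbrokenSet_rotate hI l x y t
    omega

/-- If an end `r` is adjacent to an inner vertex `w` of `p`, then `w` or one of its neighbours
along `p` is an end after one more rotation. -/
theorem Reach.posa (h : Reach G C p i q) {r u w v : V} (hr : r ∈ q.getLast?) (hrw : G.Adj r w)
    (hp : [u, w, v] <:+: p) (hu : u ∈ C) (hv : v ∈ C) (hw : w ∉ ends G C p i) :
    u ∈ ends G C p (i + 1) ∨ v ∈ ends G C p (i + 1) := by
  by_cases hu' : u ∈ ends G C p i
  · exact Or.inl (ends_mono (Nat.le_succ i) hu')
  by_cases hv' : v ∈ ends G C p i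
  · exact Or.inr (ends_mono (Nat.le_succ i) hv')
  have key : ∀ u v : V, v ∈ C → [u, w, v] <:+: q → v ∈ ends G C p (i + 1) := by
    rintro u v hv ⟨s, t, rfl⟩
    have e : s ++ [u, w, v] ++ t = (s ++ [u]) ++ w :: v :: t := by simp
    rw [e] at h hr
    have hr' : (v :: t).getLast (by simp) = r := by
      rw [List.getLast?_append_of_ne_nil _ (by simp), List.getLast?_cons_cons,
        List.getLast?_eq_getLast_of_ne_nil (List.cons_ne_nil _ _)] at hr
      simpa using hr
    exact (Reach.rotate h hv (by rw [hr']; exact hrw.symm)).rotate_getLast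
  -- None of the three vertices has been an end, so the triple survives in `q` up to reversal. Its
  -- orientation decides whether rotating at `w` exposes `v` or `u`.
  have hub := h.unbroken (I := [u, w, v]) (Or.inl hp) (by simp [hu', hv', hw])
  rcases hub with hub | hub
  · exact Or.inr (key u v hv hub)
  · exact Or.inl (key v u hu (by simpa using hub))

end Rotations

theorem infix_left_of_triple {V : Type*} {p : List V} {u w v : V} (h : [u, w, v] <:+: p) : [u, w] <:+: p :=
  List.IsInfix.trans ⟨[], [v], rfl⟩ h

theorem infix_right_of_triple {V : Type*} {p : List V} {u w v : V} (h : [u, w, v] <:+: p) : [w, v] <:+: p :=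
  List.IsInfix.trans ⟨[u], [], rfl⟩ h

/-! ### Expansion into a prescribed set of middle vertices -/

section Expansion

variable {V : Type*} [Fintype V] {G : SimpleGraph V}

theorem mem_extNeighbors {S : Finset V} {v : V} :
    v ∈ extNeighbors G S ↔ v ∉ S ∧ ∃ u ∈ S, G.Adj u v := by
  simp [extNeighbors]

/-- Any two disjoint vertex sets with at least `b` vertices each are joined by an edge. -/
def Linked (G : SimpleGraph V) (b : ℕ) : Prop :=
  ∀ A B : Finset V, Disjoint A B → b ≤ A.card → b ≤ B.card → ∃ a ∈ A, ∃ c ∈ B, G.Adj a c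

variable [DecidableEq V]

/-- No edge joins `S` to the part of `W` outside `S` and its neighbourhood, so that part has fewer
than `b` vertices. -/
theorem Linked.card_lt {b : ℕ} (h : Linked G b) {S W : Finset V} (hS : b ≤ S.card) :
    W.card < S.card + (W ∩ extNeighbors G S).card + b := by
  classical
  by_contra hcon
  have h1 : W.card ≤ (W \ S).card + S.card := by
    have := Finset.le_card_sdiff S W
    omega
  have h2 : (W \ S).card ≤ ((W \ S) \ extNeighbors G S).card + (W ∩ extNeighbors G S).card := by
    rw [← Finset.card_sdiff_add_card_inter (W \ S) (extNeighbors G S)]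
    have := Finset.card_le_card
      (Finset.inter_subset_inter_right (u := extNeighbors G S) (Finset.sdiff_subset (s := W) (t := S)))
    omega
  obtain ⟨a, ha, c, hc, hac⟩ := h S ((W \ S) \ extNeighbors G S)
    (by
      rw [Finset.disjoint_left]
      intro x hx hx'
      simp [hx] at hx') hS (by omega)
  simp only [Finset.mem_sdiff, mem_extNeighbors, not_and, not_exists] at hc
  exact hc.2 hc.1.2 a ha hac

open scoped Classical in
/-- The middle vertices of the triples in `Tri` whose outer vertices avoid `Z`. -/
noncomputable def middles (Tri : V → V → V → Prop) (Z : Finset V) : Finset V :=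
  Finset.univ.filter fun w => ∃ u v, Tri u w v ∧ u ∉ Z ∧ v ∉ Z

variable {Tri : V → V → V → Prop} {p : List V}

theorem mem_middles {Z : Finset V} {w : V} :
    w ∈ middles Tri Z ↔ ∃ u v, Tri u w v ∧ u ∉ Z ∧ v ∉ Z := by
  simp [middles]

theorem card_middles_le (hp : p.Nodup) (hTri : ∀ u w v, Tri u w v → [u, w, v] <:+: p)
    (Z : Finset V) : (middles Tri ∅).card ≤ (middles Tri Z).card + 2 * Z.card := by
  classical
  have h1 : (middles Tri ∅ \ middles Tri Z).card ≤ 2 * Z.card := by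
    refine card_le_two_mul_of_neighbors hp fun w hw => ?_
    rw [Finset.mem_sdiff, mem_middles, mem_middles] at hw
    obtain ⟨⟨u, v, h, -, -⟩, h2⟩ := hw
    have hi := hTri u w v h
    by_cases hu : u ∈ Z
    · exact ⟨u, hu, Or.inl (infix_left_of_triple hi)⟩
    by_cases hv : v ∈ Z
    · exact ⟨v, hv, Or.inr (infix_right_of_triple hi)⟩
    exact absurd ⟨u, v, h, hu, hv⟩ h2
  have h2 := Finset.le_card_sdiff (middles Tri Z) (middles Tri ∅)
  omega

/-- After the removal of fewer than `b` vertices, all small sets expand into the middles. -/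
theorem Linked.exists_exceptional {b : ℕ} (h : Linked G b) (hp : p.Nodup)
    (hTri : ∀ u w v, Tri u w v → [u, w, v] <:+: p) (hcard : 11 * b ≤ (middles Tri ∅).card) :
    ∃ Z : Finset V, Z.card < b ∧ ∀ S : Finset V, Disjoint S Z → S.Nonempty → S.card ≤ b →
      2 * S.card < (middles Tri Z ∩ extNeighbors G S).card := by
  classical
  -- A largest non-expanding set serves as `Z`. The cap `2 * b` leaves room to add a set of at most
  -- `b` vertices to one of fewer than `b`.
  let F : Finset (Finset V) := Finset.univ.filter fun Z =>
    (middles Tri Z ∩ extNeighbors G Z).card ≤ 2 * Z.card ∧ Z.card ≤ 2 * b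
  have hF : ∀ Z, Z ∈ F ↔ (middles Tri Z ∩ extNeighbors G Z).card ≤ 2 * Z.card ∧
      Z.card ≤ 2 * b := fun Z => by simp [F]
  -- If `b ≤ |Z| ≤ 2b`, linkedness gives fewer than `3|Z| + b ≤ 7b` middles avoiding `Z`, whereas at
  -- least `11b - 2|Z| ≥ 7b` of them remain.
  have hsmall : ∀ Z ∈ F, Z.card < b := by
    intro Z hZ
    rw [hF] at hZ
    by_contra hcon
    have h1 := card_middles_le hp hTri Z
    have h2 := h.card_lt (S := Z) (W := middles Tri Z) (by omega)
    omega
  have hne : F.Nonempty := ⟨∅, by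
    rw [hF]
    have : extNeighbors G (∅ : Finset V) = ∅ := by
      ext v; simp [mem_extNeighbors]
    simp [this]⟩
  obtain ⟨Z, hZ, hmax⟩ := Finset.exists_max_image F Finset.card hne
  refine ⟨Z, hsmall Z hZ, fun S hSZ hS hSb => ?_⟩
  by_contra hcon
  -- A disjoint `S` that fails to expand could be added to `Z`, contradicting maximality.
  have hmem : Z ∪ S ∈ F := by
    have hZb := hsmall Z hZ
    rw [hF] at hZ ⊢
    have hc : (Z ∪ S).card = Z.card + S.card := Finset.card_union_of_disjoint hSZ.symm
    have hmono : ∀ Y ⊆ Z ∪ S, middles Tri (Z ∪ S) ⊆ middles Tri Y := by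
      intro Y hY w hw
      rw [mem_middles] at hw ⊢
      obtain ⟨u, v, h1, h2, h3⟩ := hw
      exact ⟨u, v, h1, fun hu => h2 (hY hu), fun hv => h3 (hY hv)⟩
    have hsub : middles Tri (Z ∪ S) ∩ extNeighbors G (Z ∪ S) ⊆
        (middles Tri Z ∩ extNeighbors G Z) ∪ (middles Tri Z ∩ extNeighbors G S) := by
      intro w hw
      rw [Finset.mem_inter, mem_extNeighbors] at hw
      obtain ⟨hw1, hw2, u, hu, huw⟩ := hw
      have hm := hmono Z Finset.subset_union_left hw1
      simp only [Finset.mem_union, not_or] at hw2 hu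
      simp only [Finset.mem_union, Finset.mem_inter, mem_extNeighbors]
      rcases hu with hu | hu
      · exact Or.inl ⟨hm, hw2.1, u, hu, huw⟩
      · exact Or.inr ⟨hm, hw2.2, u, hu, huw⟩
    have := (Finset.card_le_card hsub).trans (Finset.card_union_le _ _)
    omega
  have h1 := hmax _ hmem
  have h2 : (Z ∪ S).card = Z.card + S.card := Finset.card_union_of_disjoint hSZ.symm
  have := hS.card_pos
  omega

/-- Rotations whose ends avoid the exceptional set produce more than `b` ends. -/
theorem exists_many_ends {b : ℕ} (hp : p.Nodup) (hch : p.IsChain G.Adj) {Z : Finset V}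
    (hTri : ∀ u w v, Tri u w v → [u, w, v] <:+: p)
    (hexp : ∀ S : Finset V, Disjoint S Z → S.Nonempty → S.card ≤ b →
      2 * S.card < (middles Tri Z ∩ extNeighbors G S).card)
    {a : V} (ha : p.getLast? = some a) (haZ : a ∉ Z) :
    ∃ R : Finset V, b < R.card ∧ ∀ r ∈ R, ∃ q : List V, q.Perm p ∧ q.IsChain G.Adj ∧
      q.head? = p.head? ∧ q.getLast? = some r := by
  classical
  let C : Set V := {v | v ∉ Z}
  let R : Finset V := Finset.univ.filter fun r => ∃ i, r ∈ ends G C p i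
  have hR : ∀ r, r ∈ R ↔ ∃ i, r ∈ ends G C p i := fun r => by simp [R]
  refine ⟨R, ?_, fun r hr => ?_⟩
  · by_contra hcon
    have h1 := hexp R (by
      rw [Finset.disjoint_left]
      intro r hr
      obtain ⟨i, hi⟩ := (hR r).1 hr
      exact ends_subset (C := C) ha haZ hi)
      ⟨a, (hR a).2 ⟨0, Reach.refl.getLast_mem_ends ha⟩⟩ (by omega)
    -- By `Reach.posa`, each middle adjacent to `R` is next to a vertex of `R` along `p`. The outer
    -- vertices of its triple avoid `Z`, so the rotation is allowed.
    refine absurd (card_le_two_mul_of_neighbors hp (W := middles Tri Z ∩ extNeighbors G R)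
      (R := R) fun w hw => ?_) (by omega)
    rw [Finset.mem_inter, mem_middles, mem_extNeighbors] at hw
    obtain ⟨⟨u, v, ht, hu, hv⟩, hwR, r, hr, hrw⟩ := hw
    have hi := hTri u w v ht
    obtain ⟨i, j, -, q, hq, hrq⟩ := (hR r).1 hr
    rcases hq.posa hrq hrw hi hu hv (fun hw => hwR ((hR w).2 ⟨j, hw⟩)) with h | h
    · exact ⟨u, (hR u).2 ⟨_, h⟩, Or.inl (infix_left_of_triple hi)⟩
    · exact ⟨v, (hR v).2 ⟨_, h⟩, Or.inr (infix_right_of_triple hi)⟩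
  · obtain ⟨i, j, -, q, hq, hrq⟩ := (hR r).1 hr
    exact ⟨q, hq.perm, hq.isChain hch, hq.head?_eq, hrq⟩

end Expansion

/-! ### Double counting of common subsets -/

section Pigeonhole

/-- Compare factor by factor: every factor of the falling factorial of `h` is at least `h + 1 - k >
h / 2`, and `M ≤ 16 * (h / 2)`. -/
theorem choose_le_pow_mul_choose {M h k : ℕ} (hM : M ≤ 8 * h) (hk : 2 * k ≤ h) :
    M.choose k ≤ 16 ^ k * h.choose k := by
  have h1 : k.factorial * M.choose k ≤ M ^ k := by
    rw [← Nat.descFactorial_eq_factorial_mul_choose]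
    exact Nat.descFactorial_le_pow M k
  have h2 : (h + 1 - k) ^ k ≤ k.factorial * h.choose k := by
    rw [← Nat.descFactorial_eq_factorial_mul_choose]
    exact Nat.pow_sub_le_descFactorial h k
  have h3 : M ^ k ≤ 16 ^ k * (h + 1 - k) ^ k := by
    rw [← mul_pow]
    exact Nat.pow_le_pow_left (by omega) k
  refine Nat.le_of_mul_le_mul_left ?_ k.factorial_pos
  calc k.factorial * M.choose k ≤ 16 ^ k * (h + 1 - k) ^ k := h1.trans h3
    _ ≤ 16 ^ k * (k.factorial * h.choose k) := Nat.mul_le_mul_left _ h2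
    _ = _ := by ring

/-- Some pair of `k`-subsets of `U` is contained in the pair `(X l, Y l)` for many `l`. -/
theorem exists_common_subsets {Λ U : Type*} [Fintype U] [DecidableEq U] {L : Finset Λ} (hL : L.Nonempty)
    (X Y : Λ → Finset U) {h k : ℕ} (hX : ∀ l ∈ L, h ≤ (X l).card) (hY : ∀ l ∈ L, h ≤ (Y l).card)
    (hU : Fintype.card U ≤ 8 * h) (hk : 2 * k ≤ h) :
    ∃ K₁ K₂ : Finset U, K₁.card = k ∧ K₂.card = k ∧
      L.card ≤ 256 ^ k * (L.filter fun l => K₁ ⊆ X l ∧ K₂ ⊆ Y l).card := by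
  classical
  let P : Finset (Finset U) := Finset.univ.powersetCard k
  have hPc : P.card = (Fintype.card U).choose k := by
    simp [P, Finset.card_powersetCard]
  have hP : ∀ K, K ∈ P ↔ K.card = k := fun K => by simp [P, Finset.mem_powersetCard]
  by_contra! hcon
  have hkU : k ≤ Fintype.card U := by
    obtain ⟨l, hl⟩ := hL
    have := (hX l hl).trans (Finset.card_le_univ _)
    omega
  have hpos : 0 < P.card := by
    rw [hPc]; exact Nat.choose_pos hkU
  -- Each `l` lies over at least `(h.choose k) ^ 2` pairs of subsets, out of at most `256 ^ k *
  -- (h.choose k) ^ 2` pairs in total.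
  have hdouble : ∑ K ∈ P ×ˢ P, (L.filter fun l => K.1 ⊆ X l ∧ K.2 ⊆ Y l).card =
      ∑ l ∈ L, ((X l).card.choose k * (Y l).card.choose k) := by
    simp_rw [Finset.card_filter]
    rw [Finset.sum_comm]
    refine Finset.sum_congr rfl fun l _ => ?_
    rw [← Finset.card_filter, ← Finset.card_powersetCard, ← Finset.card_powersetCard,
      ← Finset.card_product]
    congr 1
    ext ⟨K₁, K₂⟩
    simp only [Finset.mem_filter, Finset.mem_product, Finset.mem_powersetCard, hP]
    tauto
  have hlow : L.card * (h.choose k * h.choose k) ≤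
      ∑ l ∈ L, ((X l).card.choose k * (Y l).card.choose k) := by
    rw [← smul_eq_mul]
    exact Finset.card_nsmul_le_sum _ _ _ fun l hl => Nat.mul_le_mul
      (Nat.choose_le_choose k (hX l hl)) (Nat.choose_le_choose k (hY l hl))
  have hup : 256 ^ k * ∑ K ∈ P ×ˢ P, (L.filter fun l => K.1 ⊆ X l ∧ K.2 ⊆ Y l).card <
      (P.card * P.card) * L.card := by
    rw [Finset.mul_sum, ← Finset.card_product, ← smul_eq_mul (P ×ˢ P).card, ← Finset.sum_const]
    refine Finset.sum_lt_sum_of_nonempty ?_ fun K hK => ?_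
    · rw [← Finset.card_pos, Finset.card_product]; positivity
    · rw [Finset.mem_product, hP, hP] at hK
      exact hcon K.1 K.2 hK.1 hK.2
  have hc := choose_le_pow_mul_choose hU hk
  rw [← hPc] at hc
  have hcc : P.card * P.card ≤ 256 ^ k * (h.choose k * h.choose k) := by
    calc P.card * P.card ≤ (16 ^ k * h.choose k) * (16 ^ k * h.choose k) := Nat.mul_le_mul hc hc
      _ = (16 * 16) ^ k * (h.choose k * h.choose k) := by rw [mul_pow]; ring
      _ = _ := by norm_num
  have : 256 ^ k * (L.card * (h.choose k * h.choose k)) <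
      256 ^ k * (h.choose k * h.choose k) * L.card :=
    (Nat.mul_le_mul_left _ (hlow.trans hdouble.ge)).trans_lt
      (hup.trans_le (Nat.mul_le_mul_right _ hcc))
  exact absurd this (by rw [not_lt]; exact le_of_eq (by ring))

end Pigeonhole

/-! ### Longest paths and closing a cycle -/

section LongestPaths

variable {V : Type*}

/-- The list `p` is the vertex list of a longest path of `G`. -/
structure IsLongestPath (G : SimpleGraph V) (p : List V) : Prop where
  nodup : p.Nodup
  isChain : p.IsChain G.Adj
  length_le : ∀ q : List V, q.Nodup → q.IsChain G.Adj → q.length ≤ p.length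

variable {G : SimpleGraph V} {p q : List V}

theorem exists_isLongestPath [Fintype V] (G : SimpleGraph V) : ∃ p, IsLongestPath G p := by
  classical
  let P : ℕ → Prop := fun l => ∃ q : List V, q.Nodup ∧ q.IsChain G.Adj ∧ q.length = l
  have hP : ∃ l, P l := ⟨0, [], List.nodup_nil, List.isChain_nil, rfl⟩
  have hbd : ∀ l, P l → l ≤ Fintype.card V := by
    rintro l ⟨q, hq, -, rfl⟩
    exact hq.length_le_card
  obtain ⟨l, hl⟩ := hP
  obtain ⟨q, hq, hch, hlen⟩ := Nat.findGreatest_spec (hbd l hl) hl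
  exact ⟨q, hq, hch, fun q' h1 h2 => hlen ▸ Nat.le_findGreatest (h1.length_le_card) ⟨q', h1, h2, rfl⟩⟩

theorem IsLongestPath.of_perm (h : IsLongestPath G p) (hq : q.Perm p) (hch : q.IsChain G.Adj) :
    IsLongestPath G q :=
  ⟨hq.nodup_iff.2 h.nodup, hch, fun q' h1 h2 => hq.length_eq ▸ h.length_le q' h1 h2⟩

theorem isChain_reverse_of_isChain (h : p.IsChain G.Adj) : p.reverse.IsChain G.Adj := by
  rw [List.isChain_reverse]
  exact h.imp fun a b hab => hab.symm

theorem IsLongestPath.mem_of_adj_getLast (h : IsLongestPath G p) {r w : V}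
    (hr : r ∈ p.getLast?) (hrw : G.Adj r w) : w ∈ p := by
  by_contra hw
  have := h.length_le (p ++ [w])
    (by
      rw [List.nodup_append]
      exact ⟨h.nodup, List.nodup_singleton w, fun a ha b hb hab => by
        simp only [List.mem_singleton] at hb
        exact hw (hb ▸ hab ▸ ha)⟩)
    (by
      rw [List.isChain_append]
      refine ⟨h.isChain, List.isChain_singleton w, fun x hx y hy => ?_⟩
      simp only [List.head?_cons, Option.mem_def, Option.some.injEq] at hy
      rw [Option.mem_def] at hx hr
      rw [hr] at hx
      simp only [Option.some.injEq] at hx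
      rw [← hx, ← hy]
      exact hrw)
  simp at this

theorem exists_triple_of_append {s t : List V} (w : V) (hs : s ≠ []) (ht : t ≠ []) :
    ∃ u v, [u, w, v] <:+: s ++ w :: t := by
  obtain ⟨v, t', rfl⟩ := List.exists_cons_of_ne_nil ht
  refine ⟨s.getLast hs, v, s.dropLast, t', ?_⟩
  conv_rhs => rw [← List.dropLast_append_getLast hs]
  simp

theorem exists_triple {w : V} (hw : w ∈ p) (hh : p.head? ≠ some w) (hl : p.getLast? ≠ some w) :
    ∃ u v, [u, w, v] <:+: p := by
  obtain ⟨s, t, rfl⟩ := List.append_of_mem hw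
  refine exists_triple_of_append w ?_ ?_
  · rintro rfl
    simp at hh
  · rintro rfl
    simp at hl

theorem exists_triple_of_mem_interior {w : V} (hw : w ∈ p.tail.dropLast) :
    ∃ u v, [u, w, v] <:+: p := by
  rcases p with _ | ⟨x, m⟩
  · simp at hw
  · rw [List.tail_cons] at hw
    have hm : m ≠ [] := by
      rintro rfl
      simp at hw
    obtain ⟨s, t, hst⟩ := List.append_of_mem hw
    have e : x :: m = (x :: s) ++ w :: (t ++ [m.getLast hm]) := by
      conv_lhs => rw [← List.dropLast_append_getLast hm, hst]
      simp
    rw [e]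
    exact exists_triple_of_append w (by simp) (by simp)

theorem isHamiltonian_of_cycle [Fintype V] [DecidableEq V] (h : IsLongestPath G p) {x y : V}
    (hx : p.head? = some x) (hy : p.getLast? = some y) (hyx : G.Adj y x)
    (hlen : 3 ≤ p.length)
    (hconn : (∃ w, w ∉ p) → ∃ z ∈ p, ∃ w, w ∉ p ∧ G.Adj z w) : G.IsHamiltonian := by
  have hall : ∀ w, w ∈ p := by
    by_contra! hcon
    obtain ⟨z, hz, w, hw, hzw⟩ := hconn hcon
    obtain ⟨s, t, hst⟩ := List.append_of_mem hz
    have e : p = (s ++ [z]) ++ t := by simp [hst]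
    have hch := h.isChain
    rw [e, List.isChain_append] at hch
    -- The cycle is opened just after `z`, giving a longest path ending in `z`, whose neighbour `w`
    -- must then lie on it.
    have hch' : (t ++ (s ++ [z])).IsChain G.Adj := by
      rw [List.isChain_append]
      refine ⟨hch.2.1, hch.1, fun a ha b hb => ?_⟩
      have hb' : p.head? = some b := by
        rw [e, List.head?_append]
        rw [Option.mem_def] at hb
        simp [hb]
      have ha' : p.getLast? = some a := by
        rw [e, List.getLast?_append]
        rw [Option.mem_def] at ha
        simp [ha]
      rw [hx] at hb'
      rw [hy] at ha'
      simp only [Option.some.injEq] at ha' hb'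
      rw [← ha', ← hb']
      exact hyx
    have hl := h.of_perm (q := t ++ (s ++ [z])) (by rw [e]; exact List.perm_append_comm) hch'
    have hmem := hl.mem_of_adj_getLast (r := z)
      (by rw [← List.append_assoc]; simp) hzw
    refine hw ?_
    rw [e]
    exact (List.perm_append_comm.mem_iff).1 hmem
  have hne : p ≠ [] := by
    rintro rfl
    simp at hlen
  have hxe : p.head hne = x := by
    rw [List.head?_eq_some_head hne] at hx
    simpa using hx
  have hye : p.getLast hne = y := by
    rw [List.getLast?_eq_getLast_of_ne_nil hne] at hy
    simpa using hy
  have hadj : G.Adj (p.getLast hne) (p.head hne) := by rw [hxe, hye]; exact hyx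
  let P := SimpleGraph.Walk.ofSupport p hne h.isChain
  have hPlen : P.length = p.length - 1 := SimpleGraph.Walk.length_ofSupport hne h.isChain
  have hP : P.IsPath := by
    rw [SimpleGraph.Walk.isPath_def, SimpleGraph.Walk.support_ofSupport]
    exact h.nodup
  have hcard : p.length = Fintype.card V := by
    rw [← List.toFinset_card_of_nodup h.nodup, ← Finset.card_univ]
    congr 1
    ext w
    simp [hall w]
  intro _
  refine ⟨_, SimpleGraph.Walk.cons hadj P, ?_⟩
  rw [SimpleGraph.Walk.isHamiltonianCycle_iff_isCycle_and_length_eq]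
  refine ⟨(SimpleGraph.Walk.cons_isCycle_iff P hadj).2 ⟨hP, fun he => ?_⟩, ?_⟩
  · rw [Sym2.eq_swap] at he
    have := hP.length_eq_one_of_mem_edges he
    omega
  · rw [SimpleGraph.Walk.length_cons]
    omega

end LongestPaths

/-! ### Growth of the set of ends under P1 and P2 -/

section Growth

variable {V : Type*} [Fintype V] {G : SimpleGraph V} {p : List V}

open scoped Classical in
/-- The last vertices of the paths obtained from `p` by at most `i` rotations. -/
noncomputable def endSet (G : SimpleGraph V) (p : List V) (i : ℕ) : Finset V :=
  Finset.univ.filter fun r => r ∈ ends G Set.univ p i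

theorem mem_endSet {i : ℕ} {r : V} : r ∈ endSet G p i ↔ r ∈ ends G Set.univ p i := by
  simp [endSet]

theorem endSet_mono {i j : ℕ} (h : i ≤ j) : endSet G p i ⊆ endSet G p j := fun _ hr =>
  mem_endSet.2 (ends_mono h (mem_endSet.1 hr))

theorem endSet_nonempty (hne : p ≠ []) (i : ℕ) : (endSet G p i).Nonempty :=
  ⟨p.getLast hne, mem_endSet.2 (ends_mono (Nat.zero_le i)
    (Reach.refl.getLast_mem_ends (List.getLast?_eq_getLast_of_ne_nil hne)))⟩

variable [DecidableEq V]

theorem endSet_subset (i : ℕ) : endSet G p i ⊆ p.toFinset := by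
  intro r hr
  obtain ⟨j, -, q, hq, hrq⟩ := mem_endSet.1 hr
  rw [List.mem_toFinset, ← hq.perm.mem_iff]
  exact List.mem_of_mem_getLast? hrq

theorem IsLongestPath.extNeighbors_subset (h : IsLongestPath G p) {i : ℕ} {S : Finset V}
    (hS : S ⊆ endSet G p i) : extNeighbors G S ⊆ p.toFinset := by
  intro w hw
  obtain ⟨-, r, hr, hrw⟩ := mem_extNeighbors.1 hw
  obtain ⟨j, -, q, hq, hrq⟩ := mem_endSet.1 (hS hr)
  rw [List.mem_toFinset, ← hq.perm.mem_iff]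
  exact (h.of_perm hq.perm (hq.isChain h.isChain)).mem_of_adj_getLast hrq hrw

/-- Every neighbour lies on `p`, and one that is not yet an end yields a new end beside it by
`Reach.posa`. The `+ 1` pays for the first vertex of `p`, which has no predecessor; the last vertex
is an end already. -/
theorem IsLongestPath.card_extNeighbors_le (h : IsLongestPath G p) (hne : p ≠ []) {i : ℕ}
    {S : Finset V} (hS : S ⊆ endSet G p i) :
    (extNeighbors G S).card ≤
      (extNeighbors G S ∩ endSet G p i).card + 2 * (endSet G p (i + 1)).card + 1 := by
  have h1 : (extNeighbors G S \ endSet G p i).card ≤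
      (((extNeighbors G S) \ endSet G p i).erase (p.head hne)).card + 1 := by
    have := Finset.pred_card_le_card_erase (s := extNeighbors G S \ endSet G p i) (a := p.head hne)
    omega
  have h2 : (((extNeighbors G S) \ endSet G p i).erase (p.head hne)).card ≤
      2 * (endSet G p (i + 1)).card := by
    refine card_le_two_mul_of_neighbors h.nodup fun w hw => ?_
    rw [Finset.mem_erase, Finset.mem_sdiff] at hw
    obtain ⟨hwh, hwN, hwe⟩ := hw
    have hwp : w ∈ p := by simpa using h.extNeighbors_subset hS hwN
    obtain ⟨-, r, hr, hrw⟩ := mem_extNeighbors.1 hwN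
    obtain ⟨u, v, hi⟩ := exists_triple hwp
      (by
        rw [List.head?_eq_some_head hne]
        exact fun hh => hwh (Option.some.inj hh).symm)
      (fun hl => hwe (mem_endSet.2 (ends_mono (Nat.zero_le i) (Reach.refl.getLast_mem_ends hl))))
    obtain ⟨j, hj, q, hq, hrq⟩ := mem_endSet.1 (hS hr)
    have hwj : w ∉ ends G Set.univ p j := fun hw => hwe (mem_endSet.2 (ends_mono hj hw))
    rcases hq.posa hrq hrw hi trivial trivial hwj with hu | hv
    · exact ⟨u, mem_endSet.2 (ends_mono (Nat.succ_le_succ hj) hu), Or.inl (infix_left_of_triple hi)⟩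
    · exact ⟨v, mem_endSet.2 (ends_mono (Nat.succ_le_succ hj) hv),
        Or.inr (infix_right_of_triple hi)⟩
  have h3 := Finset.card_sdiff_add_card_inter (extNeighbors G S) (endSet G p i)
  omega

theorem IsLongestPath.card_extNeighbors_endSet_le (h : IsLongestPath G p) (hne : p ≠ []) (i : ℕ) :
    (extNeighbors G (endSet G p i)).card ≤ 2 * (endSet G p (i + 1)).card + 1 := by
  have h1 := h.card_extNeighbors_le hne (S := endSet G p i) (i := i) subset_rfl
  have h2 : extNeighbors G (endSet G p i) ∩ endSet G p i = ∅ := by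
    ext v
    simp only [Finset.mem_inter, mem_extNeighbors, Finset.notMem_empty, iff_false]
    tauto
  rw [h2, Finset.card_empty] at h1
  omega

variable {d : ℝ} {s₀ : ℕ}

/-- With `E`, `E'` consecutive end sets, `d|E| ≤ |N(E)| ≤ 2|E'| + 1` gives `|E'| ≥ (d - 1)|E| / 2`,
as `|E| ≥ 1`. -/
theorem IsLongestPath.pow_le_card_endSet (h : IsLongestPath G p) (hne : p ≠ []) (hd : 1 ≤ d)
    (hP1 : ∀ S : Finset V, S.card ≤ s₀ → d * S.card ≤ (extNeighbors G S).card) (i : ℕ) :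
    s₀ ≤ (endSet G p i).card ∨ ((d - 1) / 2) ^ i ≤ ((endSet G p i).card : ℝ) := by
  induction i with
  | zero =>
    right
    rw [pow_zero]
    exact_mod_cast (endSet_nonempty hne 0).card_pos
  | succ i ih =>
    by_cases hs : s₀ ≤ (endSet G p i).card
    · exact Or.inl (hs.trans (Finset.card_le_card (endSet_mono (Nat.le_succ i))))
    · right
      have hg := ih.resolve_left hs
      have h1 := hP1 (endSet G p i) (by omega)
      have h2 : ((extNeighbors G (endSet G p i)).card : ℝ) ≤ 2 * (endSet G p (i + 1)).card + 1 := by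
        exact_mod_cast h.card_extNeighbors_endSet_le hne i
      have h3 : (1 : ℝ) ≤ (endSet G p i).card := by
        exact_mod_cast (endSet_nonempty hne i).card_pos
      rw [pow_succ]
      have h4 : ((d - 1) / 2) ^ i * ((d - 1) / 2) ≤ (endSet G p i).card * ((d - 1) / 2) :=
        mul_le_mul_of_nonneg_right hg (by linarith)
      linarith

theorem IsLongestPath.many_ends (h : IsLongestPath G p) (hne : p ≠ []) {b t : ℕ} (hd : 1 ≤ d)
    (hP1 : ∀ S : Finset V, S.card ≤ s₀ → d * S.card ≤ (extNeighbors G S).card)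
    (hP2 : Linked G b) (hpow : (s₀ : ℝ) ≤ ((d - 1) / 2) ^ t) (hs₀ : 3 * (b : ℝ) + 1 ≤ d * s₀)
    (hb : 4 * (b + 1) ≤ Fintype.card V) :
    Fintype.card V ≤ 4 * (endSet G p (t + 2)).card ∧ Fintype.card V ≤ p.length + b := by
  have h0 : s₀ ≤ (endSet G p t).card := by
    rcases h.pow_le_card_endSet hne hd hP1 t with h | h
    · exact h
    · exact_mod_cast hpow.trans h
  have h1 : b ≤ (endSet G p (t + 1)).card := by
    -- P1 covers only sets of at most `s₀` vertices, so it is applied to a subset of exactly that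
    -- size; its neighbours may already be ends, whence the factor 3 below.
    obtain ⟨S, hS, hSc⟩ := Finset.exists_subset_card_eq h0
    have h2 := hP1 S hSc.le
    have h3 := h.card_extNeighbors_le hne hS
    have h4 : (extNeighbors G S ∩ endSet G p t).card ≤ (endSet G p (t + 1)).card :=
      Finset.card_le_card (Finset.inter_subset_right.trans (endSet_mono (Nat.le_succ t)))
    have h5 : ((extNeighbors G S).card : ℝ) ≤ 3 * (endSet G p (t + 1)).card + 1 := by
      exact_mod_cast (by omega : (extNeighbors G S).card ≤ 3 * (endSet G p (t + 1)).card + 1)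
    rw [hSc] at h2
    have h6 : (b : ℝ) ≤ (endSet G p (t + 1)).card := by linarith
    exact_mod_cast h6
  -- All but fewer than `b` vertices are now ends or neighbours of ends. This bounds both the next
  -- end set and the length of `p`, which contains them all.
  have h2 := hP2.card_lt (S := endSet G p (t + 1)) (W := Finset.univ) h1
  rw [Finset.univ_inter, Finset.card_univ] at h2
  have h3 := h.card_extNeighbors_endSet_le hne (t + 1)
  have h4 := Finset.card_le_card (endSet_mono (G := G) (p := p) (Nat.le_succ (t + 1)))
  refine ⟨?_, ?_⟩
  · simp only [Nat.succ_eq_add_one, add_assoc, Nat.reduceAdd] at h3 h4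
    omega
  · have hdisj : Disjoint (endSet G p (t + 1)) (extNeighbors G (endSet G p (t + 1))) := by
      rw [Finset.disjoint_left]
      intro v hv hv'
      exact (mem_extNeighbors.1 hv').1 hv
    have h5 := Finset.card_le_card (Finset.union_subset (endSet_subset (G := G) (p := p) (t + 1))
      (h.extNeighbors_subset (S := endSet G p (t + 1)) subset_rfl))
    rw [Finset.card_union_of_disjoint hdisj, List.toFinset_card_of_nodup h.nodup] at h5
    omega

/-- A subset of `Z` of size `min |Z| s₀` has, together with its neighbours, more vertices than `Z`.
-/
theorem exists_adj_of_expansion {b : ℕ} (hd : 0 < d)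
    (hP1 : ∀ S : Finset V, S.card ≤ s₀ → d * S.card ≤ (extNeighbors G S).card)
    (hs₀ : 3 * (b : ℝ) + 1 ≤ d * s₀) {Z : Finset V} (hZ : Z.Nonempty) (hZb : Z.card ≤ b) :
    ∃ z, z ∉ Z ∧ ∃ w ∈ Z, G.Adj z w := by
  have key : ∃ S ⊆ Z, Z.card < S.card + (extNeighbors G S).card := by
    by_cases hs : Z.card ≤ s₀
    · refine ⟨Z, subset_rfl, ?_⟩
      have h1 := hP1 Z hs
      have h2 : (0 : ℝ) < Z.card := by exact_mod_cast hZ.card_pos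
      have h3 : (0 : ℝ) < (extNeighbors G Z).card := lt_of_lt_of_le (by positivity) h1
      have h4 : 0 < (extNeighbors G Z).card := by exact_mod_cast h3
      omega
    · obtain ⟨S, hS, hSc⟩ := Finset.exists_subset_card_eq (not_le.1 hs).le
      refine ⟨S, hS, ?_⟩
      have h1 := hP1 S hSc.le
      rw [hSc] at h1
      have h2 : (Z.card : ℝ) ≤ b := by exact_mod_cast hZb
      have h3 : (Z.card : ℝ) < (extNeighbors G S).card := by linarith [Nat.cast_nonneg (α := ℝ) b]
      have h4 : Z.card < (extNeighbors G S).card := by exact_mod_cast h3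
      omega
  obtain ⟨S, hS, hlt⟩ := key
  have hdisj : Disjoint S (extNeighbors G S) := by
    rw [Finset.disjoint_left]
    intro v hv hv'
    exact (mem_extNeighbors.1 hv').1 hv
  have hns : ¬ S ∪ extNeighbors G S ⊆ Z := fun hsub => by
    have := Finset.card_le_card hsub
    rw [Finset.card_union_of_disjoint hdisj] at this
    omega
  obtain ⟨z, hz, hzZ⟩ := Finset.not_subset.1 hns
  rw [Finset.mem_union] at hz
  have hzN := hz.resolve_left fun h => hzZ (hS h)
  obtain ⟨-, w, hw, hwz⟩ := mem_extNeighbors.1 hzN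
  exact ⟨z, hzZ, w, hS hw, hwz.symm⟩

end Growth

/-! ### Blocks of a path and their orientations -/

section Blocks

variable {V : Type*}

/-- The `j`-th block of `s` consecutive entries of `p`. -/
def block (p : List V) (s j : ℕ) : List V := (p.drop (j * s)).take s

theorem block_infix (p : List V) (s j : ℕ) : block p s j <:+: p :=
  (List.take_prefix _ _).isInfix.trans (List.drop_suffix _ _).isInfix

theorem length_block {p : List V} {s j : ℕ} (h : (j + 1) * s ≤ p.length) :
    (block p s j).length = s := by
  rw [block, List.length_take, List.length_drop]
  rw [add_mul, one_mul] at h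
  omega

theorem block_disjoint {p : List V} (hp : p.Nodup) (s : ℕ) {i j : ℕ} (hij : i ≠ j) :
    (block p s i).Disjoint (block p s j) := by
  have key : ∀ i j : ℕ, i < j → (block p s i).Disjoint (block p s j) := by
    intro i j hij x hx hx'
    have h1 : x ∈ p.take (i * s + s) := by
      rw [block, List.take_drop] at hx
      exact List.mem_of_mem_drop hx
    have h2 : x ∈ p.drop (j * s) := List.mem_of_mem_take hx'
    refine List.disjoint_take_drop hp ?_ h1 h2
    calc i * s + s = (i + 1) * s := by ring
      _ ≤ j * s := Nat.mul_le_mul_right s hij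
  rcases lt_or_gt_of_ne hij with h | h
  · exact key i j h
  · exact (key j i h).symm

variable {ι : Type*}

/-- The block with index `o.1`, reversed if `o.2` is `false`. -/
def orientedBlock (I : ι → List V) (o : ι × Bool) : List V :=
  if o.2 then I o.1 else (I o.1).reverse

theorem mem_orientedBlock {I : ι → List V} {o : ι × Bool} {x : V} :
    x ∈ orientedBlock I o ↔ x ∈ I o.1 := by
  unfold orientedBlock
  split_ifs <;> simp

theorem length_orientedBlock (I : ι → List V) (o : ι × Bool) :
    (orientedBlock I o).length = (I o.1).length := by
  unfold orientedBlock
  split_ifs <;> simp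

variable [Fintype ι]

open scoped Classical in
/-- The unbroken blocks of `q`, each with an orientation in which it occurs in `q`. -/
noncomputable def orientations (I : ι → List V) (q : List V) : Finset (ι × Bool) :=
  (unbrokenSet I q).image fun j => (j, decide (I j <:+: q))

theorem card_orientations (I : ι → List V) (q : List V) :
    (orientations I q).card = (unbrokenSet I q).card := by
  classical
  exact Finset.card_image_of_injective _ fun _ _ h => congrArg Prod.fst h

theorem orientedBlock_infix {I : ι → List V} {q : List V} {o : ι × Bool}
    (ho : o ∈ orientations I q) : orientedBlock I o <:+: q := by
  classical
  obtain ⟨j, hj, rfl⟩ := Finset.mem_image.1 ho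
  simp only [unbrokenSet, Finset.mem_filter, Finset.mem_univ, true_and] at hj
  by_cases h : I j <:+: q
  · simp [orientedBlock, h]
  · simpa [orientedBlock, h] using hj.resolve_left h

/-- Each block is recorded with one orientation only, so distinct members of a subfamily are
disjoint as vertex sets. -/
theorem orientations_injOn (I : ι → List V) (q : List V) :
    Set.InjOn Prod.fst (orientations I q : Set (ι × Bool)) := by
  classical
  rintro o ho o' ho' h
  obtain ⟨j, -, rfl⟩ := Finset.mem_image.1 ho
  obtain ⟨j', -, rfl⟩ := Finset.mem_image.1 ho'
  simp only at h
  rw [h]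

/-- The triples of consecutive entries of the oriented blocks in `K`. -/
def blockTriple (I : ι → List V) (K : Finset (ι × Bool)) (u w v : V) : Prop :=
  ∃ o ∈ K, [u, w, v] <:+: orientedBlock I o

theorem blockTriple_infix {I : ι → List V} {q : List V} {K : Finset (ι × Bool)}
    (hK : K ⊆ orientations I q) (u w v : V) (h : blockTriple I K u w v) : [u, w, v] <:+: q := by
  obtain ⟨o, ho, h⟩ := h
  exact h.trans (orientedBlock_infix (hK ho))

theorem card_middles_blockTriple [Fintype V] [DecidableEq V] {I : ι → List V} {q : List V} {s : ℕ}
    (hI : Pairwise fun i j => (I i).Disjoint (I j)) (hs : ∀ j, (I j).length = s) (hq : q.Nodup)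
    {K : Finset (ι × Bool)} (hK : K ⊆ orientations I q) :
    K.card * (s - 2) ≤ (middles (blockTriple I K) ∅).card := by
  let f : ι × Bool → Finset V := fun o => (orientedBlock I o).tail.dropLast.toFinset
  have hf : ∀ o x, x ∈ f o → x ∈ orientedBlock I o := fun o x hx =>
    List.mem_of_mem_tail (List.mem_of_mem_dropLast (List.mem_toFinset.1 hx))
  have h1 : (K.biUnion f).card = K.card * (s - 2) := by
    rw [Finset.card_biUnion, Finset.sum_const_nat (m := s - 2)]
    · intro o ho
      have hnd : (orientedBlock I o).Nodup := (orientedBlock_infix (hK ho)).sublist.nodup hq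
      have : (orientedBlock I o).tail.dropLast.Nodup :=
        ((List.dropLast_sublist _).trans (List.tail_sublist _)).nodup hnd
      rw [List.toFinset_card_of_nodup this, List.length_dropLast, List.length_tail,
        length_orientedBlock, hs]
      omega
    · intro o ho o' ho' hne
      rw [Function.onFun, Finset.disjoint_left]
      intro x hx hx'
      refine hI (fun h => hne (orientations_injOn I q (hK ho) (hK ho') h))
        (mem_orientedBlock.1 (hf o x hx)) (mem_orientedBlock.1 (hf o' x hx'))
  rw [← h1]
  refine Finset.card_le_card fun w hw => ?_
  obtain ⟨o, ho, hwo⟩ := Finset.mem_biUnion.1 hw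
  obtain ⟨u, v, h⟩ := exists_triple_of_mem_interior (List.mem_toFinset.1 hwo)
  exact mem_middles.2 ⟨u, v, ⟨o, ho, h⟩, by simp, by simp⟩

end Blocks

/-! ### Good pairs of ends and the main argument -/

section Main

variable {V : Type*} [Fintype V] [DecidableEq V] {G : SimpleGraph V}

/-- Two halves of a longest path whose free ends avoid the exceptional sets can be rotated so
that the path closes up to a cycle. -/
theorem IsLongestPath.exists_closing {b : ℕ} (hG : Linked G b) {q₁ q₂ : List V}
    (h : IsLongestPath G (q₁ ++ q₂)) (hne₁ : q₁ ≠ []) (hne₂ : q₂ ≠ [])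
    {Tri₁ Tri₂ : V → V → V → Prop} {Z₁ Z₂ : Finset V}
    (hTri₁ : ∀ u w v, Tri₁ u w v → [u, w, v] <:+: q₁.reverse)
    (hTri₂ : ∀ u w v, Tri₂ u w v → [u, w, v] <:+: q₂)
    (hexp₁ : ∀ S : Finset V, Disjoint S Z₁ → S.Nonempty → S.card ≤ b →
      2 * S.card < (middles Tri₁ Z₁ ∩ extNeighbors G S).card)
    (hexp₂ : ∀ S : Finset V, Disjoint S Z₂ → S.Nonempty → S.card ≤ b →
      2 * S.card < (middles Tri₂ Z₂ ∩ extNeighbors G S).card)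
    (hZ₁ : q₁.head hne₁ ∉ Z₁) (hZ₂ : q₂.getLast hne₂ ∉ Z₂) :
    ∃ (p : List V) (x y : V), p.Perm (q₁ ++ q₂) ∧ p.IsChain G.Adj ∧ p.head? = some x ∧ p.getLast? = some y ∧
      G.Adj y x := by
  have hnd := List.nodup_append.1 h.nodup
  have hch := List.isChain_append.1 h.isChain
  obtain ⟨R₁, hR₁, hR₁'⟩ := exists_many_ends (p := q₁.reverse) (List.nodup_reverse.2 hnd.1)
    (isChain_reverse_of_isChain hch.1) hTri₁ hexp₁ (a := q₁.head hne₁)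
    (by rw [List.getLast?_reverse, List.head?_eq_some_head hne₁]) hZ₁
  obtain ⟨R₂, hR₂, hR₂'⟩ := exists_many_ends (p := q₂) hnd.2.1 hch.2.1 hTri₂ hexp₂
    (a := q₂.getLast hne₂) (List.getLast?_eq_getLast_of_ne_nil hne₂) hZ₂
  obtain ⟨x, hx, y, hy, hxy⟩ := hG R₁ R₂ (by
    rw [Finset.disjoint_left]
    intro r hr hr'
    obtain ⟨p₁, hp₁, -, -, hl₁⟩ := hR₁' r hr
    obtain ⟨p₂, hp₂, -, -, hl₂⟩ := hR₂' r hr'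
    have h1 : r ∈ q₁ := by
      have := hp₁.mem_iff.1 (List.mem_of_getLast? hl₁)
      simpa using this
    have h2 : r ∈ q₂ := hp₂.mem_iff.1 (List.mem_of_getLast? hl₂)
    exact hnd.2.2 r h1 r h2 rfl) hR₁.le hR₂.le
  obtain ⟨p₁, hp₁, hc₁, hh₁, hl₁⟩ := hR₁' x hx
  obtain ⟨p₂, hp₂, hc₂, hh₂, hl₂⟩ := hR₂' y hy
  -- Both rotations fix the vertex at the cut, so the edge joining the halves is still there.
  refine ⟨p₁.reverse ++ p₂, x, y, ?_, ?_, ?_, ?_, hxy.symm⟩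
  · exact List.Perm.append (((List.reverse_perm _).trans hp₁).trans (List.reverse_perm _)) hp₂
  · rw [List.isChain_append]
    refine ⟨isChain_reverse_of_isChain hc₁, hc₂, fun u hu v hv => ?_⟩
    rw [List.getLast?_reverse, hh₁, List.head?_reverse] at hu
    rw [hh₂] at hv
    exact hch.2.2 u hu v hv
  · rw [List.head?_append, List.head?_reverse, hl₁]
    rfl
  · rw [List.getLast?_append, hl₂]
    rfl

open scoped Classical in
/-- The pairs of ends of paths on the vertices of `p` in which at least `c` blocks survive. -/
noncomputable def goodPairs (G : SimpleGraph V) {ι : Type*} [Fintype ι] (I : ι → List V)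
    (p : List V) (c : ℕ) : Finset (V × V) :=
  Finset.univ.filter fun x => ∃ q : List V, q.Perm p ∧ q.IsChain G.Adj ∧ q.head? = some x.1 ∧
    q.getLast? = some x.2 ∧ c ≤ (unbrokenSet I q).card

theorem IsLongestPath.card_goodPairs {p : List V} (h : IsLongestPath G p) {i n c : ℕ}
    {ι : Type*} [Fintype ι] {I : ι → List V} (hI : Pairwise fun i j => (I i).Disjoint (I j))
    (hc : c + 2 * i ≤ (unbrokenSet I p).card)
    (hends : ∀ q, q.Perm p → q.IsChain G.Adj → n ≤ 4 * (endSet G q i).card) :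
    n * n ≤ 16 * (goodPairs G I p c).card := by
  have hq : ∀ x : V, ∃ q : List V, x ∈ endSet G p i →
      q.Perm p ∧ q.IsChain G.Adj ∧ q.head? = some x ∧
        (unbrokenSet I p).card ≤ (unbrokenSet I q).card + i := by
    intro x
    by_cases hx : x ∈ endSet G p i
    · obtain ⟨j, hj, q, hq, hqx⟩ := mem_endSet.1 hx
      -- Reversal puts the new end `x` in front, where the second round of rotations keeps it fixed.
      refine ⟨q.reverse, fun _ => ⟨(List.reverse_perm _).trans hq.perm,
        isChain_reverse_of_isChain (hq.isChain h.isChain), ?_, ?_⟩⟩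
      · rw [List.head?_reverse]; exact hqx
      · have h1 := hq.card_unbrokenSet hI
        have h2 := card_unbrokenSet_reverse I q
        omega
    · exact ⟨[], fun hx' => absurd hx' hx⟩
  choose f hf using hq
  have hcard : ((endSet G p i).sigma fun x => endSet G (f x) i).card ≤
      (goodPairs G I p c).card := by
    refine Finset.card_le_card_of_injOn (fun y => (y.1, y.2)) ?_ ?_
    · rintro ⟨x, y⟩ hxy
      rw [Finset.mem_coe, Finset.mem_sigma] at hxy
      obtain ⟨hx, hy⟩ := hxy
      obtain ⟨hp, hch, hh, hu⟩ := hf x hx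
      obtain ⟨j, hj, q, hq, hqy⟩ := mem_endSet.1 hy
      simp only [goodPairs, Finset.coe_filter, Finset.mem_univ, true_and, Set.mem_ofPred_eq]
      refine ⟨q, hq.perm.trans hp, hq.isChain hch, hq.head?_eq.trans hh, hqy, ?_⟩
      have := hq.card_unbrokenSet hI
      dsimp only at this
      omega
    · rintro ⟨x, y⟩ - ⟨x', y'⟩ - hxy
      simp only [Prod.mk.injEq] at hxy
      rw [hxy.1, hxy.2]
  rw [Finset.card_sigma] at hcard
  have h1 := hends p (List.Perm.refl _) h.isChain
  have h2 : (endSet G p i).card * n ≤ ∑ x ∈ endSet G p i, 4 * (endSet G (f x) i).card := by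
    rw [← smul_eq_mul]
    refine Finset.card_nsmul_le_sum _ _ _ fun x hx => ?_
    exact hends (f x) (hf x hx).1 (hf x hx).2.1
  rw [← Finset.mul_sum] at h2
  calc n * n ≤ 4 * (endSet G p i).card * n := Nat.mul_le_mul_right _ h1
    _ = 4 * ((endSet G p i).card * n) := by ring
    _ ≤ 4 * (4 * ∑ x ∈ endSet G p i, (endSet G (f x) i).card) := Nat.mul_le_mul_left _ h2
    _ ≤ _ := by omega

/-- Here `t + 2` is the number of rotations per end, `s` the block length, `h` the number of blocks
per half and `k` the number fixed by pigeonhole. Of `3h + 1` blocks at most `2(t + 2) ≤ h` are lost,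
leaving `2h + 1` for the cut. -/
theorem isHamiltonian_of_parameters {d : ℝ} {s₀ b t h k s : ℕ} (hd : 1 ≤ d)
    (hP1 : ∀ S : Finset V, S.card ≤ s₀ → d * S.card ≤ (extNeighbors G S).card)
    (hP2 : Linked G b) (hb : 1 ≤ b) (hpow : (s₀ : ℝ) ≤ ((d - 1) / 2) ^ t)
    (hs₀ : 3 * (b : ℝ) + 1 ≤ d * s₀) (hbn : 4 * (b + 1) ≤ Fintype.card V)
    (hth : 2 * (t + 2) ≤ h) (hkh : 2 * k ≤ h) (hsn : 2 * (s * (3 * h + 1)) ≤ Fintype.card V)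
    (hks : 11 * b ≤ k * (s - 2)) (hbk : 32 * b * 256 ^ k ≤ Fintype.card V) :
    G.IsHamiltonian := by
  classical
  obtain ⟨p, hp⟩ := exists_isLongestPath G
  have hV : 0 < Fintype.card V := by omega
  have hpne : p ≠ [] := by
    rintro rfl
    obtain ⟨v⟩ := Fintype.card_pos_iff.1 hV
    have := hp.length_le [v] (List.nodup_singleton v) (List.isChain_singleton v)
    simp at this
  have hmany : ∀ q, q.Perm p → q.IsChain G.Adj →
      Fintype.card V ≤ 4 * (endSet G q (t + 2)).card ∧ Fintype.card V ≤ q.length + b := by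
    intro q hq hch
    refine (hp.of_perm hq hch).many_ends ?_ hd hP1 hP2 hpow hs₀ hbn
    rintro rfl
    exact hpne (List.nil_perm.1 hq)
  have hplen := (hmany p (List.Perm.refl _) hp.isChain).2
  have hs : 2 < s := by
    by_contra hcon
    rw [Nat.sub_eq_zero_of_le (by omega), mul_zero] at hks
    omega
  let I : Fin (3 * h + 1) → List V := fun j => block p s j
  have hI : Pairwise fun i j => (I i).Disjoint (I j) := fun i j hij =>
    block_disjoint hp.nodup s fun hh => hij (Fin.ext hh)
  have hIs : ∀ j, (I j).length = s := fun j => length_block (by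
    have h1 : (j.1 + 1) * s ≤ (3 * h + 1) * s := Nat.mul_le_mul_right s j.2
    rw [mul_comm s] at hsn
    omega)
  have hIp : (unbrokenSet I p).card = 3 * h + 1 := by
    have : unbrokenSet I p = Finset.univ := by
      ext j
      simp only [unbrokenSet, Finset.mem_filter, Finset.mem_univ, true_and, iff_true]
      exact Or.inl (block_infix p s j)
    rw [this, Finset.card_univ, Fintype.card_fin]
  have hgood := hp.card_goodPairs hI (i := t + 2) (c := 2 * h + 1) (by omega)
    fun q hq hch => (hmany q hq hch).1
  set L := goodPairs G I p (2 * h + 1) with hL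
  have hcut : ∀ x : V × V, ∃ q : List V × List V, x ∈ L → (q.1 ++ q.2).Perm p ∧
      (q.1 ++ q.2).IsChain G.Adj ∧ (q.1 ++ q.2).head? = some x.1 ∧
      (q.1 ++ q.2).getLast? = some x.2 ∧ h ≤ (unbrokenSet I q.1).card ∧
      h ≤ (unbrokenSet I q.2).card := by
    intro x
    by_cases hx : x ∈ L
    · simp only [hL, goodPairs, Finset.mem_filter, Finset.mem_univ, true_and] at hx
      obtain ⟨q, h1, h2, h3, h4, h5⟩ := hx
      obtain ⟨q₁, q₂, rfl, h6, h7⟩ := exists_cut hI h5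
      exact ⟨(q₁, q₂), fun _ => ⟨h1, h2, h3, h4, h6, h7⟩⟩
    · exact ⟨([], []), fun hx' => absurd hx' hx⟩
  choose f hf using hcut
  have hLne : L.Nonempty := by
    rw [← Finset.card_pos]
    by_contra hcon
    have : 0 < Fintype.card V * Fintype.card V := Nat.mul_pos hV hV
    omega
  obtain ⟨K₁, K₂, hK₁, hK₂, hcard⟩ := exists_common_subsets hLne
    (fun x => orientations I (f x).1.reverse) (fun x => orientations I (f x).2) (h := h) (k := k)
    (fun x hx => by
      rw [card_orientations]
      exact (hf x hx).2.2.2.2.1.trans (card_unbrokenSet_reverse I _))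
    (fun x hx => by
      rw [card_orientations]
      exact (hf x hx).2.2.2.2.2)
    (by
      rw [Fintype.card_prod, Fintype.card_fin, Fintype.card_bool]
      omega) hkh
  set L' := L.filter fun x => K₁ ⊆ orientations I (f x).1.reverse ∧ K₂ ⊆ orientations I (f x).2
    with hL'
  have hL'big : 2 * b * Fintype.card V ≤ L'.card := by
    have h1 : 16 * 256 ^ k * (2 * b * Fintype.card V) ≤ 16 * 256 ^ k * L'.card := by
      calc 16 * 256 ^ k * (2 * b * Fintype.card V) = 32 * b * 256 ^ k * Fintype.card V := by ring
        _ ≤ Fintype.card V * Fintype.card V := Nat.mul_le_mul_right _ hbk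
        _ ≤ 16 * (256 ^ k * L'.card) := hgood.trans (Nat.mul_le_mul_left _ hcard)
        _ = _ := by ring
    exact Nat.le_of_mul_le_mul_left h1 (by positivity)
  have hsub : ∀ x ∈ L', x ∈ L ∧ K₁ ⊆ orientations I (f x).1.reverse ∧
      K₂ ⊆ orientations I (f x).2 := fun x hx => by simpa [hL'] using hx
  have hnd : ∀ x ∈ L, ((f x).1 ++ (f x).2).Nodup := fun x hx =>
    (hf x hx).1.nodup_iff.2 hp.nodup
  -- One pair of `L'` suffices to build `Z₁` and `Z₂`, since they depend only on `K₁` and `K₂`; they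
  -- then serve all of `L'`.
  have hZ : ∃ Z₁ Z₂ : Finset V, Z₁.card < b ∧ Z₂.card < b ∧
      (∀ S : Finset V, Disjoint S Z₁ → S.Nonempty → S.card ≤ b →
        2 * S.card < (middles (blockTriple I K₁) Z₁ ∩ extNeighbors G S).card) ∧
      (∀ S : Finset V, Disjoint S Z₂ → S.Nonempty → S.card ≤ b →
        2 * S.card < (middles (blockTriple I K₂) Z₂ ∩ extNeighbors G S).card) := by
    have hpos : 0 < L'.card := lt_of_lt_of_le (by positivity) hL'big
    obtain ⟨x, hx⟩ := Finset.card_pos.1 hpos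
    obtain ⟨hxL, hx1, hx2⟩ := hsub x hx
    have hnd := List.nodup_append.1 (hnd x hxL)
    have hnd1 := List.nodup_reverse.2 hnd.1
    obtain ⟨Z₁, h1, h2⟩ := hP2.exists_exceptional hnd1 (blockTriple_infix hx1)
      (hks.trans (hK₁ ▸ card_middles_blockTriple hI hIs hnd1 hx1))
    obtain ⟨Z₂, h3, h4⟩ := hP2.exists_exceptional hnd.2.1 (blockTriple_infix hx2)
      (hks.trans (hK₂ ▸ card_middles_blockTriple hI hIs hnd.2.1 hx2))
    exact ⟨Z₁, Z₂, h1, h3, h2, h4⟩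
  obtain ⟨Z₁, Z₂, hZ₁, hZ₂, hexp₁, hexp₂⟩ := hZ
  -- Fewer than `2bn` pairs meet an exceptional set, while `L'` has at least `2bn`.
  have hpair : ∃ x ∈ L', x.1 ∉ Z₁ ∧ x.2 ∉ Z₂ := by
    by_contra! hcon
    have h1 : L' ⊆ (Z₁ ×ˢ Finset.univ) ∪ (Finset.univ ×ˢ Z₂) := by
      intro x hx
      simp only [Finset.mem_union, Finset.mem_product, Finset.mem_univ, and_true, true_and]
      by_cases hx1 : x.1 ∈ Z₁
      · exact Or.inl hx1
      · exact Or.inr (hcon x hx hx1)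
    have h2 := (Finset.card_le_card h1).trans (Finset.card_union_le _ _)
    rw [Finset.card_product, Finset.card_product, Finset.card_univ] at h2
    have h3 : Z₁.card * Fintype.card V < b * Fintype.card V := Nat.mul_lt_mul_of_pos_right hZ₁ hV
    have h4 : Fintype.card V * Z₂.card < Fintype.card V * b := Nat.mul_lt_mul_of_pos_left hZ₂ hV
    have h5 : 2 * b * Fintype.card V = b * Fintype.card V + Fintype.card V * b := by ring
    omega
  obtain ⟨x, hx, hx1, hx2⟩ := hpair
  obtain ⟨hxL, hK1, hK2⟩ := hsub x hx
  obtain ⟨hperm, hch, hhead, hlast, hu1, hu2⟩ := hf x hxL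
  have hne : ∀ q : List V, h ≤ (unbrokenSet I q).card → q ≠ [] := by
    rintro q hq rfl
    obtain ⟨j, hj⟩ := Finset.card_pos.1 (lt_of_lt_of_le (by omega : 0 < h) hq)
    simp only [unbrokenSet, Finset.mem_filter, Finset.mem_univ, true_and, Unbroken,
      List.infix_nil, List.reverse_eq_nil_iff, or_self] at hj
    have := hIs j
    rw [hj, List.length_nil] at this
    omega
  have hne1 := hne _ hu1
  have hne2 := hne _ hu2
  have hlp := hp.of_perm hperm hch
  obtain ⟨c, y, z, hcp, hcc, hcy, hcz, hadj⟩ := hlp.exists_closing hP2 hne1 hne2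
    (blockTriple_infix hK1) (blockTriple_infix hK2) hexp₁ hexp₂
    (by
      rw [List.head?_append, List.head?_eq_some_head hne1] at hhead
      have e : (f x).1.head hne1 = x.1 := by simpa using hhead
      rw [e]; exact hx1)
    (by
      rw [List.getLast?_append, List.getLast?_eq_getLast_of_ne_nil hne2] at hlast
      have e : (f x).2.getLast hne2 = x.2 := by simpa using hlast
      rw [e]; exact hx2)
  have hlc := hlp.of_perm hcp hcc
  have hclen := (hmany c (hcp.trans hperm) hcc).2
  refine isHamiltonian_of_cycle hlc hcy hcz hadj (by omega) ?_
  rintro ⟨w, hw⟩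
  obtain ⟨z, hz, w, hw, hzw⟩ := exists_adj_of_expansion (Z := c.toFinsetᶜ) (lt_of_lt_of_le one_pos hd)
    hP1 hs₀ ⟨w, by simpa using hw⟩ (by
      rw [Finset.card_compl, List.toFinset_card_of_nodup hlc.nodup]
      omega)
  exact ⟨z, by simpa using hz, w, by simpa using hw, hzw⟩

end Main

/-! ### Choice of the numerical parameters -/

section Parameters

open Filter

/-- For `d ≥ 12` one has `d ≤ ((d - 1) / 2) ^ 2`, so the growth factor is at least `√d`. -/
theorem le_pow_ceil {d : ℝ} (hd : 12 ≤ d) {n : ℕ} (hn : 0 < n) :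
    (n : ℝ) ≤ ((d - 1) / 2) ^ ⌈2 * Real.log n / Real.log d⌉₊ := by
  have hl : 0 < Real.log d := Real.log_pos (by linarith)
  have hg : 0 < (d - 1) / 2 := by linarith
  have hlog : Real.log d ≤ 2 * Real.log ((d - 1) / 2) := by
    have h1 : Real.log d ≤ Real.log (((d - 1) / 2) ^ 2) :=
      Real.log_le_log (by linarith) (by nlinarith)
    rw [Real.log_pow] at h1
    exact_mod_cast h1
  have hn' : (0 : ℝ) < n := by exact_mod_cast hn
  rw [← Real.log_le_log_iff hn' (by positivity), Real.log_pow]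
  have h2 := Nat.le_ceil (2 * Real.log n / Real.log d)
  rw [div_le_iff₀ hl] at h2
  have h3 : (0 : ℝ) ≤ (⌈2 * Real.log n / Real.log d⌉₊ : ℝ) := Nat.cast_nonneg _
  nlinarith

theorem pow_floor_le_exp {y : ℝ} (hy : 0 ≤ y) : (256 : ℝ) ^ ⌊y / 20⌋₊ ≤ Real.exp (y / 3) := by
  have h1 := Nat.floor_le (show 0 ≤ y / 20 by positivity)
  have h2 : (256 : ℝ) = Real.exp (8 * Real.log 2) := by
    rw [mul_comm, Real.exp_mul, Real.exp_log two_pos]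
    norm_num
  rw [h2, ← Real.exp_nat_mul]
  apply Real.exp_le_exp.2
  have := Real.log_two_lt_d9
  have h3 : (0 : ℝ) < Real.log 2 := Real.log_pos one_lt_two
  nlinarith

/-- In use, `r ^ 3 = log n`, `y = log log n`, `z = log log log n`, `l = log d` and `D = n / m`. The
size of `k` is a compromise: `256 ^ k` must stay below `m`, yet `k` blocks must have `11b` interior
vertices. -/
theorem exists_parameters {n : ℕ} {d r y z l D : ℝ} (hd : 12 ≤ d) (hl : 2 ≤ l) (hlr : l ≤ r)
    (hr : 10 ≤ r) (hyr : y ≤ r) (hy : 40 ≤ y) (hz : 14 ≤ z) (hzy : z ≤ y)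
    (hn : 4130 * r ^ 3 ≤ n) (hD : D = n / (r ^ 3 * z / (y * l))) (hDd : 1 ≤ D / d)
    (hpow : (n : ℝ) ≤ ((d - 1) / 2) ^ ⌈2 * r ^ 3 / l⌉₊)
    (hexp : (256 : ℝ) ^ ⌊y / 20⌋₊ ≤ r) :
    ∃ s₀ b t h k s : ℕ, (s₀ : ℝ) ≤ D / d ∧ D / 4130 ≤ b ∧ 1 ≤ b ∧
      (s₀ : ℝ) ≤ ((d - 1) / 2) ^ t ∧ 3 * (b : ℝ) + 1 ≤ d * s₀ ∧ 4 * (b + 1) ≤ n ∧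
      2 * (t + 2) ≤ h ∧ 2 * k ≤ h ∧ 2 * (s * (3 * h + 1)) ≤ n ∧ 11 * b ≤ k * (s - 2) ∧
      32 * b * 256 ^ k ≤ n := by
  have hr0 : 0 < r := by linarith
  have hl0 : 0 < l := by linarith
  have hy0 : 0 < y := by linarith
  have hz0 : 0 < z := by linarith
  have hn0 : (0 : ℝ) < n := lt_of_lt_of_le (by positivity) hn
  set M := r ^ 3 * z / (y * l) with hM
  have hM0 : 0 < M := by positivity
  have hrM : r ≤ M := by
    rw [hM, le_div_iff₀ (by positivity)]
    have h1 : y * l ≤ r * r := mul_le_mul hyr hlr hl0.le hr0.le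
    calc r * (y * l) ≤ r * (r * r) := mul_le_mul_of_nonneg_left h1 hr0.le
      _ = r ^ 3 * 1 := by ring
      _ ≤ r ^ 3 * z := mul_le_mul_of_nonneg_left (by linarith) (by positivity)
  have hMr : M ≤ r ^ 3 := by
    rw [hM, div_le_iff₀ (by positivity)]
    have : z ≤ y * l := hzy.trans (le_mul_of_one_le_right hy0.le (by linarith))
    exact mul_le_mul_of_nonneg_left this (by positivity)
  have hDM : D * M = n := by rw [hD, div_mul_cancel₀ _ hM0.ne']
  have hD0 : 0 < D := by rw [hD]; positivity
  have hDbig : 4130 ≤ D := by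
    rw [hD, le_div_iff₀ hM0]
    linarith
  have hDn : D ≤ n := hDM ▸ le_mul_of_one_le_right hD0.le (by linarith)
  have hxl : r ^ 2 ≤ r ^ 3 / l := by
    rw [le_div_iff₀ hl0]
    calc r ^ 2 * l ≤ r ^ 2 * r := mul_le_mul_of_nonneg_left hlr (by positivity)
      _ = r ^ 3 := by ring
  have hb1 := Nat.le_ceil (D / 4130)
  have hb2 := Nat.ceil_lt_add_one (show 0 ≤ D / 4130 by positivity)
  have hs1 := Nat.floor_le (show 0 ≤ D / d by linarith)
  have hs2 := Nat.lt_floor_add_one (D / d)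
  have ht1 := Nat.le_ceil (2 * r ^ 3 / l)
  have ht2 := Nat.ceil_lt_add_one (show 0 ≤ 2 * r ^ 3 / l by positivity)
  have hk1 := Nat.floor_le (show 0 ≤ y / 20 by positivity)
  have hk2 := Nat.lt_floor_add_one (y / 20)
  have hs3 : (1 : ℝ) ≤ ⌊D / d⌋₊ := by exact_mod_cast Nat.one_le_floor_iff _ |>.2 hDd
  have hd0 : 0 < d := by linarith
  have hds : D / 2 ≤ d * ⌊D / d⌋₊ := by
    have : D / d ≤ 2 * ⌊D / d⌋₊ := by linarith
    rw [div_le_iff₀ hd0] at this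
    linarith
  have hpos : 1 ≤ ⌈D / 4130⌉₊ := Nat.one_le_ceil_iff.2 (by positivity)
  have e2 : 2 * r ^ 3 / l = 2 * (r ^ 3 / l) := by ring
  rw [e2] at ht1 ht2 hpow
  set q := r ^ 3 / l with hq
  set t := ⌈2 * q⌉₊
  set b := ⌈D / 4130⌉₊
  set k := ⌊y / 20⌋₊
  set s₀ := ⌊D / d⌋₊
  have hr2 : 10 * r ≤ r ^ 2 := by
    rw [pow_two]
    exact mul_le_mul_of_nonneg_right hr hr0.le
  have hq0 : 100 ≤ q := by linarith
  refine ⟨s₀, b, t, 2 * (t + 2), k, n / (2 * (3 * (2 * (t + 2)) + 1)), hs1, hb1, hpos, ?_, ?_, ?_,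
    le_rfl, ?_, ?_, ?_, ?_⟩
  · refine hs1.trans (le_trans ?_ hpow)
    exact (div_le_self hD0.le (by linarith)).trans hDn
  · linarith
  · have : (4 : ℝ) * (b + 1) ≤ n := by linarith
    exact_mod_cast this
  · have : (2 : ℝ) * k ≤ 2 * (t + 2) := by linarith
    exact_mod_cast this
  · have := Nat.div_mul_le_self n (2 * (3 * (2 * (t + 2)) + 1))
    calc _ = n / (2 * (3 * (2 * (t + 2)) + 1)) * (2 * (3 * (2 * (t + 2)) + 1)) := by ring
      _ ≤ n := this
  · set N := 2 * (3 * (2 * (t + 2)) + 1) with hN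
    have hN1 : (N : ℝ) ≤ 32 * q := by
      rw [hN]; push_cast; linarith
    have hN0 : (0 : ℝ) < N := by rw [hN]; push_cast; positivity
    have h1 : (n : ℝ) / N - 1 < (n / N : ℕ) := by
      have := Nat.lt_succ_floor ((n : ℝ) / N)
      rw [Nat.floor_div_natCast, Nat.floor_natCast] at this
      push_cast at this
      linarith
    have h2 : (n : ℝ) / (32 * q) ≤ n / N := div_le_div_of_nonneg_left hn0.le hN0 hN1
    have h3 : ((n / N : ℕ) : ℝ) - 2 ≤ ((n / N - 2 : ℕ) : ℝ) := by
      have : n / N ≤ n / N - 2 + 2 := by omega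
      have : ((n / N : ℕ) : ℝ) ≤ ((n / N - 2 : ℕ) : ℝ) + 2 := by exact_mod_cast this
      linarith
    have hqr : q ≤ r ^ 3 := by
      exact div_le_self (by positivity) (by linarith)
    have h4 : 6 ≤ (n : ℝ) / (32 * q) := by
      rw [le_div_iff₀ (by positivity)]
      linarith
    have h5 : (n : ℝ) / (64 * q) ≤ ((n / N - 2 : ℕ) : ℝ) := by
      have : (n : ℝ) / (64 * q) = n / (32 * q) / 2 := by field_simp; norm_num
      linarith
    have h6 : y / 40 ≤ k := by linarith
    have h7 : y / 40 * (n / (64 * q)) ≤ k * ((n / N - 2 : ℕ) : ℝ) :=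
      mul_le_mul h6 h5 (by positivity) (by positivity)
    have h8 : 11 * (b : ℝ) ≤ 22 * (D / 4130) := by linarith
    have h9 : 22 * (D / 4130) ≤ y / 40 * (n / (64 * q)) := by
      have e1 : D = n * y / (q * z) := by
        rw [hD, hM, hq]
        field_simp
      -- The `k` blocks contribute at least `D z / 2560` vertices, and `z ≥ 14` makes this exceed
      -- `22 D / 4130`.
      rw [e1, show y / 40 * (n / (64 * q)) = n * y / (q * z) * (z / 2560) by field_simp; norm_num]
      have e3 : ∀ a : ℝ, 0 < a → 22 * (a / 4130) ≤ a * (z / 2560) := fun a ha => by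
        have := mul_le_mul_of_nonneg_left hz ha.le
        linarith
      exact e3 _ (by positivity)
    have : (11 : ℝ) * b ≤ k * ((n / N - 2 : ℕ) : ℝ) := h8.trans (h9.trans h7)
    exact_mod_cast this
  · have h1 : 32 * (b : ℝ) ≤ D / 2 := by linarith
    have : (32 : ℝ) * b * 256 ^ k ≤ n := by
      calc (32 : ℝ) * b * 256 ^ k ≤ D / 2 * M :=
            mul_le_mul h1 (hexp.trans hrM) (by positivity) (by positivity)
        _ ≤ n := by linarith
    exact_mod_cast this

theorem eventually_large : ∀ᶠ n : ℕ in atTop,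
    10 ≤ Real.log n ^ ((1 : ℝ) / 3) ∧ Real.log (Real.log n) ≤ Real.log n ^ ((1 : ℝ) / 3) ∧
      40 ≤ Real.log (Real.log n) ∧ 14 ≤ Real.log (Real.log (Real.log n)) ∧
      4130 * Real.log n ≤ n := by
  have hx : Tendsto (fun n : ℕ => Real.log n) atTop atTop :=
    Real.tendsto_log_atTop.comp tendsto_natCast_atTop_atTop
  have hy := Real.tendsto_log_atTop.comp hx
  have hz := Real.tendsto_log_atTop.comp hy
  have hr := (tendsto_rpow_atTop (show (0 : ℝ) < 1 / 3 by norm_num)).comp hx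
  have h1 : ∀ᶠ x : ℝ in atTop, Real.log x ≤ x ^ ((1 : ℝ) / 3) := by
    have := (isLittleO_log_rpow_atTop (show (0 : ℝ) < 1 / 3 by norm_num)).bound one_pos
    filter_upwards [this, eventually_ge_atTop 1] with x hx hx1
    rw [one_mul, Real.norm_of_nonneg (Real.log_nonneg hx1),
      Real.norm_of_nonneg (by positivity)] at hx
    exact hx
  have h2 : ∀ᶠ x : ℝ in atTop, 4130 * Real.log x ≤ x := by
    have := Real.isLittleO_log_id_atTop.bound (show (0 : ℝ) < 1 / 4130 by norm_num)
    filter_upwards [this, eventually_ge_atTop 1] with x hx hx1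
    rw [Real.norm_of_nonneg (Real.log_nonneg hx1), id, Real.norm_of_nonneg (by linarith)] at hx
    linarith
  filter_upwards [hr.eventually_ge_atTop 10, hx.eventually h1, hy.eventually_ge_atTop 40,
    hz.eventually_ge_atTop 14, tendsto_natCast_atTop_atTop.eventually h2] with n a1 a2 a3 a4 a5
  exact ⟨a1, a2, a3, a4, a5⟩

end Parameters

end HamiltonExpansion

theorem theorem1 :
    ∃ n₀ : ℕ, ∀ n : ℕ, n₀ ≤ n →
      ∀ d : ℝ, 12 ≤ d → d ≤ Real.exp ((Real.log n) ^ ((1 : ℝ) / 3)) →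
        ∀ (V : Type*) [Fintype V] [DecidableEq V] (G : SimpleGraph V),
          Fintype.card V = n →
          HamiltonExpansion.P1 G d → HamiltonExpansion.P2 G d → G.IsHamiltonian := by
  obtain ⟨n₀, hn₀⟩ := Filter.eventually_atTop.1 HamiltonExpansion.eventually_large
  refine ⟨n₀, fun n hn d hd hdr V _ _ G hV hP1 hP2 => ?_⟩
  obtain ⟨hr, hyr, hy, hz, hnx⟩ := hn₀ n hn
  set x := Real.log n with hx
  set r := x ^ ((1 : ℝ) / 3) with hrdef
  set y := Real.log x with hydef
  set z := Real.log y with hzdef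
  set l := Real.log d with hldef
  have hx0 : 0 < x := by
    by_contra hcon
    rcases (not_lt.1 hcon).lt_or_eq with h | h
    · exact absurd (Real.log_natCast_nonneg n) (not_le.2 h)
    -- The convention `log 0 = 0` would give `y = 0`, against `40 ≤ y`.
    · rw [hydef, h, Real.log_zero] at hy
      linarith
  have hr3 : r ^ 3 = x := by
    rw [hrdef, ← Real.rpow_natCast, ← Real.rpow_mul hx0.le]
    norm_num
  have hn0 : 0 < n := by
    rcases Nat.eq_zero_or_pos n with h | h
    · rw [hx, h] at hx0
      simp at hx0
    · exact h
  have hn0' : (0 : ℝ) < n := by exact_mod_cast hn0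
  have hl : 2 ≤ l := by
    rw [hldef, Real.le_log_iff_exp_le (by linarith)]
    have h1 := Real.exp_one_lt_d9
    have h2 : Real.exp 2 = Real.exp 1 * Real.exp 1 := by rw [← Real.exp_add]; norm_num
    rw [h2]
    nlinarith [Real.exp_pos 1]
  have hlr : l ≤ r := by
    rw [hldef, Real.log_le_iff_le_exp (by linarith)]
    exact hdr
  have hzy : z ≤ y := Real.log_le_self (by linarith)
  have hm : HamiltonExpansion.m n d = x * z / (y * l) := rfl
  have hm0 : 0 < x * z / (y * l) := by
    have : 0 < y := by linarith
    have : 0 < z := by linarith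
    have : 0 < l := by linarith
    positivity
  have hmx : x * z / (y * l) ≤ x := by
    rw [div_le_iff₀ (by nlinarith)]
    have : z ≤ y * l := by nlinarith
    exact mul_le_mul_of_nonneg_left this hx0.le
  -- The upper bound on `d` gives `m d ≤ exp (y + r) ≤ exp (r ^ 3) = n`, so P1 applies at least to
  -- single vertices.
  have hDd : 1 ≤ (n : ℝ) / (x * z / (y * l)) / d := by
    rw [div_div, one_le_div (by positivity)]
    have h1 : x = Real.exp y := (Real.exp_log hx0).symm
    have h2 : (n : ℝ) = Real.exp x := (Real.exp_log hn0').symm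
    calc x * z / (y * l) * d ≤ x * Real.exp r :=
          mul_le_mul hmx hdr (by linarith) hx0.le
      _ = Real.exp (y + r) := by rw [Real.exp_add, ← h1]
      _ ≤ Real.exp x := by
          apply Real.exp_le_exp.2
          rw [← hr3]
          nlinarith [sq_nonneg r]
      _ = n := h2.symm
  obtain ⟨s₀, b, t, h, k, s, hs₀, hb, hb1, hpow, hds, hbn, hth, hkh, hsn, hks, hbk⟩ :=
    HamiltonExpansion.exists_parameters (n := n) (r := r) (y := y) (z := z) (l := l) hd hl hlr hr
      hyr hy hz hzy (by rw [hr3]; exact hnx) (D := n / (x * z / (y * l))) (by rw [hr3]) hDd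
      (by rw [hr3]; exact HamiltonExpansion.le_pow_ceil hd hn0)
      ((HamiltonExpansion.pow_floor_le_exp (by linarith)).trans (by
        rw [hrdef, Real.rpow_def_of_pos hx0]
        exact le_of_eq (congrArg Real.exp (by rw [hydef]; ring))))
  unfold HamiltonExpansion.P1 at hP1
  unfold HamiltonExpansion.P2 at hP2
  rw [hV, hm] at hP1 hP2
  subst hV
  refine HamiltonExpansion.isHamiltonian_of_parameters (by linarith) (fun S hS => ?_)
    (fun A B hAB hA hB => ?_) hb1 hpow hds hbn hth hkh hsn hks hbk
  · refine hP1 S ?_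
    rw [mul_comm d, ← div_div]
    exact le_trans (by exact_mod_cast hS) hs₀
  · rw [mul_comm (4130 : ℝ), ← div_div] at hP2
    exact hP2 A B hAB (hb.trans (by exact_mod_cast hA)) (hb.trans (by exact_mod_cast hB))
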